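/- For integers $n,k\ge 1$, let $U,V$ be independent random unitary matrices, each distributed according to the Haar probability measure on the unitary group $\mathcal U(nk)$ of $\mathbb C^n\otimes\mathbb C^k$. Let $Y_1,Y_2\in\mathcal M_k(\mathbb C)$ be rank-one orthogonal projectors (deterministic, and allowed to depend on $n$ and $k$). Let $$\Phi^{U}(X)=\operatorname{Tr}_{\mathbb C^k}\!\left[U(X\otimes Y_1)U^*\right],\qquad \Phi^{V}(X)=\operatorname{Tr}_{\mathbb C^k}\!\left[V(X\otimes Y_2)V^*\right],\qquad X\in\mathcal M_n(\mathbb C),$$ let $E_n=\frac1n\sum_{i,j=1}^n |e_i\rangle\langle e_j|\otimes|e_i\rangle\langle e_j|$ be the maximally entangled (Bell) state, and let $Z=[\Phi^U\otimes\Phi^V](E_n)\in\mathcal M_{n^2}(\mathbb C)$, a Hermitian random matrix. 1. (First regime: $n\ge 1$ fixed, $k\to\infty$.) For every integer $p\ge1$, $\operatorname{Tr}(Z^p)$ is integrable and $$\lim_{k\to\infty}\mathbb E[\operatorname{Tr}(Z^p)]=n^{2-2p},$$ which is the $p$-th moment $\operatorname{Tr}(\rho_*^p)$ of the chaotic (maximally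 mixed) state $\rho_*=I_{n^2}/n^2$. Moreover, $Z$ converges to $\rho_*$ in probability in operator norm, and the empirical eigenvalue distribution $\mu_Z=\frac1{n^2}\sum_{i=1}^{n^2}\delta_{\lambda_i(Z)}$ converges weakly in probability to $\delta_{1/n^2}$: for every bounded continuous $f:\mathbb R\to\mathbb R$, $\int f\,d\mu_Z\to f(1/n^2)$ in probability. 2. (Second regime: $k\ge 1$ fixed, $n\to\infty$.) For every integer $p\ge1$, $\operatorname{Tr}(Z^p)$ is integrable and $$\lim_{n\to\infty}\mathbb E[\operatorname{Tr}(Z^p)]=k^{2-2p}.$$ Moreover, asymptotically the eigenvalues of $Z$ are $1/k^2$ with multiplicity $k^2$ and $0$ with multiplicity $n^2-k^2$: for every $\varepsilon>0$, the probability that, among the $n^2$ eigenvalues of $Z$ counted with multiplicity, some $k^2$ lie within distance less than $\varepsilon$ of $1/k^2$ and the other $n^2-k^2$ are equal to $0$, tends to $1$ as $n\to\infty$. -/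

import Mathlib

open MeasureTheory ProbabilityTheory Filter Topology
open scoped Kronecker BoundedContinuousFunction

/-- The partial trace over the second (environment) tensor factor. -/
def partialTrace {n k : ℕ} (M : Matrix (Fin n × Fin k) (Fin n × Fin k) ℂ) :
    Matrix (Fin n) (Fin n) ℂ :=
  fun i j => ∑ a, M (i, a) (j, a)

/-- The channel in Stinespring form, `Φ^{U,Y}(X) = Tr_K [U (X ⊗ Y) U^*]`. -/
def stinespringChannel {n k : ℕ} (Y : Matrix (Fin k) (Fin k) ℂ)
    (U : Matrix.unitaryGroup (Fin n × Fin k) ℂ) (X : Matrix (Fin n) (Fin n) ℂ) :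
    Matrix (Fin n) (Fin n) ℂ :=
  partialTrace ((U : Matrix (Fin n × Fin k) (Fin n × Fin k) ℂ) * (X ⊗ₖ Y) *
    star (U : Matrix (Fin n × Fin k) (Fin n × Fin k) ℂ))

theorem stinespringChannel_add {n k : ℕ} (Y : Matrix (Fin k) (Fin k) ℂ)
    (U : Matrix.unitaryGroup (Fin n × Fin k) ℂ) (X X' : Matrix (Fin n) (Fin n) ℂ) :
    stinespringChannel Y U (X + X') = stinespringChannel Y U X + stinespringChannel Y U X' := by
  ext i j
  simp [stinespringChannel, partialTrace, Matrix.add_kronecker, mul_add, add_mul,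
    Finset.sum_add_distrib]

theorem stinespringChannel_smul {n k : ℕ} (Y : Matrix (Fin k) (Fin k) ℂ)
    (U : Matrix.unitaryGroup (Fin n × Fin k) ℂ) (c : ℂ) (X : Matrix (Fin n) (Fin n) ℂ) :
    stinespringChannel Y U (c • X) = c • stinespringChannel Y U X := by
  ext i j
  simp [stinespringChannel, partialTrace, Matrix.smul_kronecker, Finset.mul_sum]

/-- The channel as a linear map on matrices. -/
def channel {n k : ℕ} (Y : Matrix (Fin k) (Fin k) ℂ)
    (U : Matrix.unitaryGroup (Fin n × Fin k) ℂ) :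
    Matrix (Fin n) (Fin n) ℂ →ₗ[ℂ] Matrix (Fin n) (Fin n) ℂ where
  toFun := stinespringChannel Y U
  map_add' := stinespringChannel_add Y U
  map_smul' := stinespringChannel_smul Y U

/-- The tensor product `Φ ⊗ Ψ` of two linear maps on matrices, expanded on matrix units. -/
def tensorMap {n : ℕ} (Φ Ψ : Matrix (Fin n) (Fin n) ℂ →ₗ[ℂ] Matrix (Fin n) (Fin n) ℂ)
    (X : Matrix (Fin n × Fin n) (Fin n × Fin n) ℂ) :
    Matrix (Fin n × Fin n) (Fin n × Fin n) ℂ :=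
  ∑ i, ∑ j, ∑ r, ∑ s,
    X (i, r) (j, s) • (Φ (Matrix.single i j 1) ⊗ₖ Ψ (Matrix.single r s 1))

/-- `tensorMap Φ Ψ` acts on product matrices by `(Φ ⊗ Ψ)(A ⊗ B) = Φ(A) ⊗ Ψ(B)`. -/
theorem tensorMap_kronecker {n : ℕ}
    (Φ Ψ : Matrix (Fin n) (Fin n) ℂ →ₗ[ℂ] Matrix (Fin n) (Fin n) ℂ)
    (A B : Matrix (Fin n) (Fin n) ℂ) :
    tensorMap Φ Ψ (A ⊗ₖ B) = Φ A ⊗ₖ Ψ B := by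
  have key : ∀ (Θ : Matrix (Fin n) (Fin n) ℂ →ₗ[ℂ] Matrix (Fin n) (Fin n) ℂ)
      (C : Matrix (Fin n) (Fin n) ℂ),
      Θ C = ∑ i, ∑ j, C i j • Θ (Matrix.single i j 1) := by
    intro Θ C
    conv_lhs => rw [Matrix.matrix_eq_sum_single C]
    simp only [map_sum]
    refine Finset.sum_congr rfl fun i _ => Finset.sum_congr rfl fun j _ => ?_
    rw [← map_smul, Matrix.smul_single, smul_eq_mul, mul_one]
  ext ⟨a, b⟩ ⟨c, d⟩
  rw [key Φ A, key Ψ B]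
  simp only [tensorMap, Matrix.sum_apply, Matrix.smul_apply, Matrix.kroneckerMap_apply,
    smul_eq_mul, Finset.sum_mul]
  simp only [Finset.mul_sum]
  refine Finset.sum_congr rfl fun i _ => Finset.sum_congr rfl fun j _ =>
    Finset.sum_congr rfl fun r _ => Finset.sum_congr rfl fun s _ => ?_
  ring

/-- The maximally entangled (Bell) state `E_n = (1/n) ∑ |e_i⟩⟨e_j| ⊗ |e_i⟩⟨e_j|`. -/
noncomputable def bellState (n : ℕ) : Matrix (Fin n × Fin n) (Fin n × Fin n) ℂ :=
  (n : ℂ)⁻¹ • ∑ i : Fin n, ∑ j : Fin n, (Matrix.single i j 1 ⊗ₖ Matrix.single i j 1)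

/-- The output `Z = (Φ^{U,Y₁} ⊗ Φ^{V,Y₂})(E_n)`. -/
noncomputable def outputState {n k : ℕ} (Y₁ Y₂ : Matrix (Fin k) (Fin k) ℂ)
    (U V : Matrix.unitaryGroup (Fin n × Fin k) ℂ) :
    Matrix (Fin n × Fin n) (Fin n × Fin n) ℂ :=
  tensorMap (channel Y₁ U) (channel Y₂ V) (bellState n)

theorem channel_conjTranspose {n k : ℕ} {Y : Matrix (Fin k) (Fin k) ℂ} (hY : IsStarProjection Y)
    (U : Matrix.unitaryGroup (Fin n × Fin k) ℂ) (X : Matrix (Fin n) (Fin n) ℂ) :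
    (channel Y U X).conjTranspose = channel Y U X.conjTranspose := by
  have hpt : ∀ M : Matrix (Fin n × Fin k) (Fin n × Fin k) ℂ,
      (partialTrace M).conjTranspose = partialTrace M.conjTranspose := by
    intro M
    ext i j
    simp [partialTrace, Matrix.conjTranspose_apply]
  have hYh : Y.conjTranspose = Y := hY.isSelfAdjoint
  change (partialTrace _).conjTranspose = partialTrace _
  rw [hpt]
  congr 1
  simp only [Matrix.star_eq_conjTranspose, Matrix.conjTranspose_mul,
    Matrix.conjTranspose_conjTranspose, Matrix.conjTranspose_kronecker, hYh, Matrix.mul_assoc]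

theorem outputState_isHermitian {n k : ℕ} {Y₁ Y₂ : Matrix (Fin k) (Fin k) ℂ}
    (h₁ : IsStarProjection Y₁) (h₂ : IsStarProjection Y₂)
    (U V : Matrix.unitaryGroup (Fin n × Fin k) ℂ) :
    (outputState Y₁ Y₂ U V).IsHermitian := by
  have hexp : outputState Y₁ Y₂ U V = (n : ℂ)⁻¹ • ∑ i : Fin n, ∑ j : Fin n,
      (channel Y₁ U (Matrix.single i j 1) ⊗ₖ channel Y₂ V (Matrix.single i j 1)) := by
    have hb : ∀ i r j s : Fin n, bellState n (i, r) (j, s) =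
        (n : ℂ)⁻¹ * if i = r ∧ j = s then 1 else 0 := by
      intro i r j s
      simp only [bellState, Matrix.smul_apply, Matrix.sum_apply, Matrix.kroneckerMap_apply,
        Matrix.single_apply, smul_eq_mul]
      congr 1
      rw [Finset.sum_eq_single i, Finset.sum_eq_single j]
      · by_cases h : i = r ∧ j = s <;> simp [h]
      · intro b _ hb; simp [hb]
      · simp
      · intro b _ hb; simp [hb]
      · simp
    simp only [outputState, tensorMap, hb, Finset.smul_sum]
    refine Finset.sum_congr rfl fun i _ => Finset.sum_congr rfl fun j _ => ?_
    rw [Finset.sum_eq_single i, Finset.sum_eq_single j]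
    · simp
    · intro b _ hb; simp [hb.symm]
    · simp
    · intro b _ hb; simp [hb.symm]
    · simp
  unfold Matrix.IsHermitian
  rw [hexp]
  simp only [Matrix.conjTranspose_smul, Matrix.conjTranspose_sum, Matrix.conjTranspose_kronecker,
    channel_conjTranspose h₁, channel_conjTranspose h₂, Matrix.conjTranspose_single, star_one,
    star_inv₀, star_natCast]
  rw [Finset.sum_comm]

/-- The eigenvalues, counted with multiplicity, of the output state. -/
noncomputable def outputEigenvalues {n k : ℕ} {Y₁ Y₂ : Matrix (Fin k) (Fin k) ℂ}
    (h₁ : IsStarProjection Y₁) (h₂ : IsStarProjection Y₂)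
    (U V : Matrix.unitaryGroup (Fin n × Fin k) ℂ) : Fin n × Fin n → ℝ :=
  (outputState_isHermitian h₁ h₂ U V).eigenvalues

/-- The empirical eigenvalue distribution `μ_Z = (1/n²) ∑ δ_{λ_i(Z)}`. -/
noncomputable def empiricalSpectrum {n k : ℕ} {Y₁ Y₂ : Matrix (Fin k) (Fin k) ℂ}
    (h₁ : IsStarProjection Y₁) (h₂ : IsStarProjection Y₂)
    (U V : Matrix.unitaryGroup (Fin n × Fin k) ℂ) : Measure ℝ :=
  ((n : ENNReal) ^ 2)⁻¹ • ∑ i, Measure.dirac (outputEigenvalues h₁ h₂ U V i)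

/-- The chaotic (maximally mixed) state `ρ_* = I / n²` on `ℂⁿ ⊗ ℂⁿ`. -/
noncomputable def chaoticState (n : ℕ) : Matrix (Fin n × Fin n) (Fin n × Fin n) ℂ :=
  ((n : ℂ) ^ 2)⁻¹ • 1

/-- The operator norm of a matrix with respect to the Euclidean norm. -/
noncomputable def opNorm {ι : Type*} [Fintype ι] [DecidableEq ι] (A : Matrix ι ι ℂ) : ℝ :=
  ‖Matrix.toEuclideanCLM (𝕜 := ℂ) A‖

/-- The Borel σ-algebra on the unitary group. -/
noncomputable instance unitaryMeasurableSpace {ι : Type*} [Fintype ι] [DecidableEq ι] :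
    MeasurableSpace (Matrix.unitaryGroup ι ℂ) := borel _

instance unitaryBorelSpace {ι : Type*} [Fintype ι] [DecidableEq ι] :
    BorelSpace (Matrix.unitaryGroup ι ℂ) := ⟨rfl⟩

/-- `U` and `V` are independent random unitary matrices, each distributed according to the Haar
probability measure (when `P` is a probability measure, so are the laws of `U` and `V`). -/
structure IsIndepHaarPair {Ω ι : Type*} [MeasurableSpace Ω] [Fintype ι] [DecidableEq ι]
    (P : Measure Ω) (U V : Ω → Matrix.unitaryGroup ι ℂ) : Prop where
  measurable_left : Measurable U
  measurable_right : Measurable V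
  haar_left : (P.map U).IsHaarMeasure
  haar_right : (P.map V).IsHaarMeasure
  indep : IndepFun U V P

/-!
The proof only uses second moments of the Haar measure. For `U` Haar distributed on the unitary
group of dimension `N` and fixed matrices `C`, `D`, the random variable `Tr(U C U^* D)` has mean
`Tr C Tr D / N` and variance at most `8 ‖C‖² ‖D‖² / N²` in the Hilbert–Schmidt norm
(`card_sq_mul_integral_norm_trace_sub_sq_le`). Indeed `D ↦ 𝔼 |Tr(U C U^* D)|²` is invariant under
unitary conjugation. On real traceless diagonal matrices, permutation invariance forces it to be a
multiple of the squared norm, and the spectral theorem extends this to traceless Hermitian matrices;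
the multiple is bounded by summing over the matrices `e_{ij} + e_{ji}`. A general matrix is split into
its Hermitian parts.

For matrices `D₁`, `D₂` consider
`F(U, V) = (1/n) ∑_{ij} Tr(U (e_{ij} ⊗ Y₁) U^* D₁) Tr(V (e_{ij} ⊗ Y₂) V^* D₂)` (`bellPairing`). For
fixed `V` it has the form `Tr(U (C ⊗ Y₁) U^* D₁) / n`, where `Tr C = Tr(V (1 ⊗ Y₂) V^* D₂)` and
`‖C‖² ≤ n` as soon as left multiplication by `D₂` does not increase the norm. Applying the variance
estimate in `U` and then in `V` bounds the mean square of the difference of `F` and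
`Tr D₁ Tr D₂ / (nk)²` by `O(max(‖D₁‖², ‖D₂‖²) / (n (nk)²))` (`integral_norm_bellPairing_sub_sq_le`).

Both regimes are instances of this estimate. With `D₁`, `D₂` of the form `e_{sr} ⊗ 1`, whose squared
norm is `k`, the variables `F` are the entries of `Z`, and they converge to those of `1/n²` when
`k → ∞`. In the second regime write `Y₁`, `Y₂` as projections on unit vectors, so that `Z = W W^*`,
where the `k²` columns of `W` are the images of the Bell vector under products of Kraus operators.
The entries of the `k² × k²` Gram matrix `W^* W` are the variables `F` with `D₁`, `D₂` of the form
`1 ⊗ e_{ac}`, whose squared norm is `n`, and they converge to those of `1/k²` when `n → ∞`. Moreover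
`W W^*` and `W^* W` have the same rank, nonzero eigenvalues and traces of powers.

In either case a random matrix of fixed size with bounded entries converges in mean square to a
scalar matrix. This yields the convergence of moments (`tendsto_integral_continuous_comp`) and, by
Markov's inequality, convergence in operator norm in probability (`tendsto_measure_le_opNorm_sub`),
from which the statements on eigenvalues follow because eigenvalues of `M` are within `‖M - c‖` of
`c`.
-/

/-! ### The Hilbert–Schmidt norm -/

/-- The square of the Hilbert–Schmidt norm of a matrix. -/
noncomputable def hsSq {ι κ : Type*} [Fintype ι] [Fintype κ] (A : Matrix ι κ ℂ) : ℝ :=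
  ∑ i, ∑ j, ‖A i j‖ ^ 2

section HilbertSchmidt

variable {ι κ : Type*} [Fintype ι] [Fintype κ]

theorem hsSq_nonneg (A : Matrix ι κ ℂ) : 0 ≤ hsSq A :=
  Finset.sum_nonneg fun _ _ => Finset.sum_nonneg fun _ _ => by positivity

theorem ofReal_hsSq (A : Matrix ι κ ℂ) : (hsSq A : ℂ) = (A.conjTranspose * A).trace := by
  simp only [hsSq, Matrix.trace, Matrix.diag_apply, Matrix.mul_apply, Matrix.conjTranspose_apply]
  rw [Finset.sum_comm]
  push_cast
  refine Finset.sum_congr rfl fun i _ => Finset.sum_congr rfl fun j _ => ?_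
  exact (Complex.conj_mul' _).symm

theorem hsSq_conjTranspose (A : Matrix ι κ ℂ) : hsSq A.conjTranspose = hsSq A := by
  simp only [hsSq, Matrix.conjTranspose_apply, norm_star]
  exact Finset.sum_comm

theorem hsSq_unitary_mul [DecidableEq ι] (U : Matrix.unitaryGroup ι ℂ) (A : Matrix ι κ ℂ) :
    hsSq ((U : Matrix ι ι ℂ) * A) = hsSq A := by
  have h : (U : Matrix ι ι ℂ).conjTranspose * (U : Matrix ι ι ℂ) = 1 :=
    Matrix.mem_unitaryGroup_iff'.1 U.2
  have : (hsSq ((U : Matrix ι ι ℂ) * A) : ℂ) = hsSq A := by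
    rw [ofReal_hsSq, ofReal_hsSq, Matrix.conjTranspose_mul, Matrix.mul_assoc,
      ← Matrix.mul_assoc _ _ A, h, Matrix.one_mul]
  exact_mod_cast this

theorem hsSq_mul_star_unitary [DecidableEq ι] (U : Matrix.unitaryGroup ι ℂ) (A : Matrix κ ι ℂ) :
    hsSq (A * star (U : Matrix ι ι ℂ)) = hsSq A := by
  rw [← hsSq_conjTranspose, Matrix.conjTranspose_mul, Matrix.star_eq_conjTranspose,
    Matrix.conjTranspose_conjTranspose, hsSq_unitary_mul, hsSq_conjTranspose]

theorem hsSq_unitary_conj [DecidableEq ι] (U : Matrix.unitaryGroup ι ℂ) (A : Matrix ι ι ℂ) :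
    hsSq ((U : Matrix ι ι ℂ) * A * star (U : Matrix ι ι ℂ)) = hsSq A := by
  rw [hsSq_mul_star_unitary, hsSq_unitary_mul]

/-- The Cauchy–Schwarz inequality for double sums of complex numbers. -/
theorem norm_sum_mul_sq_le (f g : ι → κ → ℂ) :
    ‖∑ i, ∑ j, f i j * g i j‖ ^ 2 ≤ (∑ i, ∑ j, ‖f i j‖ ^ 2) * ∑ i, ∑ j, ‖g i j‖ ^ 2 := by
  simp only [← Fintype.sum_prod_type']
  calc ‖∑ x : ι × κ, f x.1 x.2 * g x.1 x.2‖ ^ 2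
      ≤ (∑ x : ι × κ, ‖f x.1 x.2‖ * ‖g x.1 x.2‖) ^ 2 := by
        gcongr
        exact (norm_sum_le _ _).trans_eq (by simp only [norm_mul])
    _ ≤ _ := Finset.sum_mul_sq_le_sq_mul_sq _ _ _

theorem norm_trace_mul_sq_le (A : Matrix ι κ ℂ) (B : Matrix κ ι ℂ) :
    ‖(A * B).trace‖ ^ 2 ≤ hsSq A * hsSq B := by
  have h := norm_sum_mul_sq_le A fun i j => B j i
  rw [Finset.sum_comm (f := fun i j => ‖B j i‖ ^ 2)] at h
  simpa only [Matrix.trace, Matrix.diag_apply, Matrix.mul_apply, hsSq] using h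

theorem hsSq_kronecker {ι' κ' : Type*} [Fintype ι'] [Fintype κ'] (A : Matrix ι κ ℂ)
    (B : Matrix ι' κ' ℂ) : hsSq (A ⊗ₖ B) = hsSq A * hsSq B := by
  rw [hsSq, hsSq, hsSq, Finset.sum_mul_sum, Fintype.sum_prod_type]
  refine Finset.sum_congr rfl fun i _ => Finset.sum_congr rfl fun i' _ => ?_
  rw [Finset.sum_mul_sum, Fintype.sum_prod_type]
  simp only [Matrix.kroneckerMap_apply, norm_mul, mul_pow]

theorem hsSq_one [DecidableEq ι] : hsSq (1 : Matrix ι ι ℂ) = Fintype.card ι := by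
  have : (hsSq (1 : Matrix ι ι ℂ) : ℂ) = (Fintype.card ι : ℝ) := by
    rw [ofReal_hsSq]; simp
  exact_mod_cast this

theorem hsSq_single [DecidableEq ι] [DecidableEq κ] (i : ι) (j : κ) :
    hsSq (Matrix.single i j (1 : ℂ)) = 1 := by
  rw [hsSq, Finset.sum_eq_single i, Finset.sum_eq_single j]
  · simp
  · intro b _ hb; simp [hb.symm]
  · simp
  · intro b _ hb; simp [hb.symm]
  · simp

theorem hsSq_sub_trace_smul_one_le [DecidableEq ι] (D : Matrix ι ι ℂ) :
    hsSq (D - (D.trace / Fintype.card ι) • (1 : Matrix ι ι ℂ)) ≤ hsSq D := by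
  set t := D.trace / Fintype.card ι with ht
  rcases isEmpty_or_nonempty ι with h | h
  · simp [hsSq]
  have hN : (Fintype.card ι : ℂ) ≠ 0 := by simp
  have htr : D.trace = Fintype.card ι * t := by rw [ht]; field_simp
  have key : (hsSq (D - t • (1 : Matrix ι ι ℂ)) : ℂ)
      = ((hsSq D - Fintype.card ι * ‖t‖ ^ 2 : ℝ) : ℂ) := by
    push_cast
    rw [ofReal_hsSq, ofReal_hsSq, ← Complex.conj_mul' t]
    simp only [Matrix.conjTranspose_sub, Matrix.conjTranspose_smul, Matrix.conjTranspose_one,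
      sub_mul, mul_sub, Matrix.trace_sub, Matrix.smul_mul, Matrix.mul_smul, Matrix.one_mul,
      Matrix.mul_one, Matrix.trace_smul, Matrix.trace_one, smul_eq_mul,
      Matrix.trace_conjTranspose, htr, star_mul', star_natCast, Complex.star_def]
    ring
  have key' : hsSq (D - t • (1 : Matrix ι ι ℂ)) = hsSq D - Fintype.card ι * ‖t‖ ^ 2 := by
    exact_mod_cast key
  rw [key']
  have : 0 ≤ (Fintype.card ι : ℝ) * ‖t‖ ^ 2 := by positivity
  linarith

end HilbertSchmidt

/-! ### The unitary group as a compact group -/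

section Unitary

variable {ι : Type*} [Fintype ι] [DecidableEq ι]

instance compactSpace_unitaryGroup : CompactSpace (Matrix.unitaryGroup ι ℂ) := by
  refine isCompact_iff_compactSpace.1 ?_
  have hK : IsCompact (Set.univ.pi fun _ : ι => Set.univ.pi fun _ : ι =>
      Metric.closedBall (0 : ℂ) 1) :=
    isCompact_univ_pi fun _ => isCompact_univ_pi fun _ => isCompact_closedBall _ _
  refine hK.of_isClosed_subset (isClosed_unitary (R := Matrix ι ι ℂ)) fun U hU => ?_
  simpa [Set.mem_pi] using fun i j => entry_norm_bound_of_unitary hU i j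

instance secondCountableTopology_unitaryGroup :
    SecondCountableTopology (Matrix.unitaryGroup ι ℂ) :=
  haveI : SecondCountableTopology (Matrix ι ι ℂ) :=
    inferInstanceAs (SecondCountableTopology (ι → ι → ℂ))
  TopologicalSpace.Subtype.secondCountableTopology _

theorem continuous_trace_unitary_conj_mul (C D : Matrix ι ι ℂ) :
    Continuous fun U : Matrix.unitaryGroup ι ℂ =>
      ((U : Matrix ι ι ℂ) * C * star (U : Matrix ι ι ℂ) * D).trace := by
  fun_prop

/-- A continuous function on a compact space is integrable with respect to a finite measure. -/
theorem Continuous.integrable_of_compactSpace {α E : Type*} [TopologicalSpace α] [CompactSpace α]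
    [MeasurableSpace α] [OpensMeasurableSpace α] [NormedAddCommGroup E]
    [SecondCountableTopologyEither α E] {f : α → E} (hf : Continuous f)
    (μ : Measure α) [IsFiniteMeasure μ] : Integrable f μ :=
  hf.integrable_of_hasCompactSupport (HasCompactSupport.of_compactSpace f)

end Unitary

/-! ### Second moments of a random conjugation -/

section ConjMoment

theorem sum_sum_mul_mul_sub_sq {ι : Type*} [Fintype ι] (d x : ι → ℝ) (hd : ∑ i, d i = 0) :
    ∑ i, ∑ j, d i * d j * (x i - x j) ^ 2 = -2 * (∑ i, d i * x i) ^ 2 := by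
  have h : ∀ i j, d i * d j * (x i - x j) ^ 2 = (d i * x i ^ 2) * d j + d i * (d j * x j ^ 2)
      - 2 * ((d i * x i) * (d j * x j)) := fun i j => by ring
  simp only [h, Finset.sum_sub_distrib, Finset.sum_add_distrib, ← Finset.mul_sum,
    ← Finset.sum_mul, hd]
  ring

/-- When the weights sum to zero, `|∑ dᵢ xᵢ|²` only depends on the differences of the `xᵢ`. -/
theorem norm_sum_ofReal_mul_sq {ι : Type*} [Fintype ι] (d : ι → ℝ) (x : ι → ℂ) (hd : ∑ i, d i = 0) :
    ‖∑ i, (d i : ℂ) * x i‖ ^ 2 = -(1 / 2) * ∑ i, ∑ j, d i * d j * ‖x i - x j‖ ^ 2 := by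
  have hre := sum_sum_mul_mul_sub_sq d (fun i => (x i).re) hd
  have him := sum_sum_mul_mul_sub_sq d (fun i => (x i).im) hd
  have hs : ∑ i, ∑ j, d i * d j * ‖x i - x j‖ ^ 2 =
      ∑ i, ∑ j, d i * d j * ((x i).re - (x j).re) ^ 2 +
        ∑ i, ∑ j, d i * d j * ((x i).im - (x j).im) ^ 2 := by
    simp only [← Finset.sum_add_distrib, Complex.sq_norm, Complex.normSq_apply, Complex.sub_re,
      Complex.sub_im]
    refine Finset.sum_congr rfl fun i _ => Finset.sum_congr rfl fun j _ => by ring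
  rw [hs, hre, him, Complex.sq_norm, Complex.normSq_apply]
  simp only [Complex.re_sum, Complex.im_sum, Complex.re_ofReal_mul, Complex.im_ofReal_mul]
  ring

variable {ι : Type*} [Fintype ι] [DecidableEq ι]

/-- The quadratic form `D ↦ 𝔼 |Tr(U C U^* D)|²`, for a random unitary `U` with law `μ`. -/
noncomputable def conjMoment (μ : Measure (Matrix.unitaryGroup ι ℂ)) (C D : Matrix ι ι ℂ) : ℝ :=
  ∫ U, ‖((U : Matrix ι ι ℂ) * C * star (U : Matrix ι ι ℂ) * D).trace‖ ^ 2 ∂μ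

theorem trace_mul_single_sub_single (X : Matrix ι ι ℂ) (i j : ι) :
    (X * (Matrix.single i i 1 - Matrix.single j j 1)).trace = X i i - X j j := by
  simp [mul_sub, Matrix.trace_mul_single]

variable (μ : Measure (Matrix.unitaryGroup ι ℂ))

/-- Left invariance of the law makes the second moment a unitarily invariant quadratic form. -/
theorem conjMoment_unitary_conj [μ.IsMulLeftInvariant] (C D : Matrix ι ι ℂ)
    (W : Matrix.unitaryGroup ι ℂ) :
    conjMoment μ C ((W : Matrix ι ι ℂ) * D * star (W : Matrix ι ι ℂ)) = conjMoment μ C D := by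
  have h := integral_mul_left_eq_self (μ := μ) (fun U : Matrix.unitaryGroup ι ℂ =>
    ‖((U : Matrix ι ι ℂ) * C * star (U : Matrix ι ι ℂ) * D).trace‖ ^ 2) (star W)
  rw [conjMoment, conjMoment, ← h]
  refine integral_congr_ae (ae_of_all _ fun U => ?_)
  simp only [Submonoid.coe_mul, Unitary.coe_star, star_mul, star_star, Matrix.mul_assoc]
  rw [Matrix.trace_mul_comm (star (W : Matrix ι ι ℂ))]
  simp only [Matrix.mul_assoc]

theorem conjMoment_smul (c : ℂ) (C D : Matrix ι ι ℂ) :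
    conjMoment μ C (c • D) = ‖c‖ ^ 2 * conjMoment μ C D := by
  simp only [conjMoment, ← integral_const_mul, Matrix.mul_smul, Matrix.trace_smul, smul_eq_mul,
    norm_mul, mul_pow]

/-- The permutation matrix of `σ` as a unitary matrix. -/
def permUnitary (σ : Equiv.Perm ι) : Matrix.unitaryGroup ι ℂ :=
  ⟨σ.permMatrix ℂ, by
    rw [Matrix.mem_unitaryGroup_iff, Matrix.star_eq_conjTranspose, Matrix.conjTranspose_permMatrix,
      ← Matrix.permMatrix_mul]
    simp⟩

theorem permUnitary_conj_single (σ : Equiv.Perm ι) (i : ι) :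
    (permUnitary σ : Matrix ι ι ℂ) * Matrix.single (σ i) (σ i) 1 *
      star (permUnitary σ : Matrix ι ι ℂ) = Matrix.single i i 1 := by
  rw [Matrix.star_eq_conjTranspose]
  simp only [permUnitary, Matrix.conjTranspose_permMatrix, Equiv.Perm.permMatrix,
    PEquiv.toMatrix_toPEquiv_mul, PEquiv.mul_toMatrix_toPEquiv]
  ext a b
  simp [Matrix.single_apply, Equiv.Perm.inv_def]

theorem conjMoment_single_sub_single_eq [μ.IsMulLeftInvariant] (C : Matrix ι ι ℂ) {i j i' j' : ι} (hij : i ≠ j)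
    (hij' : i' ≠ j') :
    conjMoment μ C (Matrix.single i i 1 - Matrix.single j j 1) =
      conjMoment μ C (Matrix.single i' i' 1 - Matrix.single j' j' 1) := by
  obtain ⟨σ, rfl, rfl⟩ : ∃ σ : Equiv.Perm ι, σ i = i' ∧ σ j = j' := by
    refine ⟨Equiv.swap (Equiv.swap i i' j) j' * Equiv.swap i i', ?_, ?_⟩
    · have : i' ≠ Equiv.swap i i' j := fun h => hij <| (Equiv.swap i i').injective <| by
        simpa using h
      simp [Equiv.swap_apply_of_ne_of_ne this hij']
    · simp
  rw [← conjMoment_unitary_conj μ C (Matrix.single (σ i) (σ i) 1 - _) (permUnitary σ)]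
  rw [mul_sub, sub_mul, permUnitary_conj_single, permUnitary_conj_single]

variable [IsProbabilityMeasure μ]

theorem integrable_norm_trace_unitary_conj_mul_sq (C D : Matrix ι ι ℂ) :
    Integrable (fun U : Matrix.unitaryGroup ι ℂ =>
      ‖((U : Matrix ι ι ℂ) * C * star (U : Matrix ι ι ℂ) * D).trace‖ ^ 2) μ :=
  ((continuous_trace_unitary_conj_mul C D).norm.pow 2).integrable_of_compactSpace μ

/-- On real traceless diagonal matrices the second moment is a multiple of the squared norm, provided
it takes the same value on all the differences `e_{ii} - e_{jj}`. -/
theorem conjMoment_diagonal (C : Matrix ι ι ℂ) {q : ℝ}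
    (hq : ∀ i j, i ≠ j →
      conjMoment μ C (Matrix.single i i 1 - Matrix.single j j 1) = q)
    (d : ι → ℝ) (hd : ∑ i, d i = 0) :
    conjMoment μ C (Matrix.diagonal fun i => (d i : ℂ)) = q / 2 * ∑ i, d i ^ 2 := by
  have hpt : ∀ U : Matrix.unitaryGroup ι ℂ,
      ‖((U : Matrix ι ι ℂ) * C * star (U : Matrix ι ι ℂ) *
        Matrix.diagonal fun i => (d i : ℂ)).trace‖ ^ 2 =
      -(1 / 2) * ∑ i, ∑ j, d i * d j * ‖((U : Matrix ι ι ℂ) * C * star (U : Matrix ι ι ℂ) *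
        (Matrix.single i i 1 - Matrix.single j j 1)).trace‖ ^ 2 := by
    intro U
    simp only [trace_mul_single_sub_single]
    rw [← norm_sum_ofReal_mul_sq d _ hd]
    congr 2
    simp only [Matrix.trace, Matrix.diag_apply, Matrix.mul_diagonal]
    exact Finset.sum_congr rfl fun i _ => mul_comm _ _
  have hq' : ∀ i j, conjMoment μ C (Matrix.single i i 1 - Matrix.single j j 1) =
      q - if i = j then q else 0 := by
    intro i j
    by_cases h : i = j
    · simp [h, conjMoment]
    · simp [h, hq i j h]
  have hint : ∀ i j, Integrable (fun U : Matrix.unitaryGroup ι ℂ => d i * d j *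
      ‖((U : Matrix ι ι ℂ) * C * star (U : Matrix ι ι ℂ) *
        (Matrix.single i i 1 - Matrix.single j j 1)).trace‖ ^ 2) μ := fun i j =>
    (integrable_norm_trace_unitary_conj_mul_sq μ C _).const_mul _
  rw [conjMoment]
  simp only [hpt]
  rw [integral_const_mul, integral_finsetSum _ fun i _ => integrable_finsetSum _ fun j _ => hint i j]
  simp only [integral_finsetSum _ fun j _ => hint _ j, integral_const_mul]
  have : ∀ i j, d i * d j * ∫ U : Matrix.unitaryGroup ι ℂ, ‖((U : Matrix ι ι ℂ) * C *
      star (U : Matrix ι ι ℂ) * (Matrix.single i i 1 - Matrix.single j j 1)).trace‖ ^ 2 ∂μ =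
      q * d i * d j - if i = j then q * d i * d j else 0 := by
    intro i j
    rw [← conjMoment, hq']
    split_ifs <;> ring
  simp only [this, Finset.sum_sub_distrib, Finset.sum_ite_eq, Finset.mem_univ, if_true,
    ← Finset.mul_sum, hd, mul_zero, Finset.sum_const_zero, Finset.sum_const_zero]
  simp only [mul_assoc, ← Finset.mul_sum, pow_two]
  ring

theorem conjMoment_add_le (C D D' : Matrix ι ι ℂ) :
    conjMoment μ C (D + D') ≤ 2 * conjMoment μ C D + 2 * conjMoment μ C D' := by
  have h := integrable_norm_trace_unitary_conj_mul_sq μ C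
  simp only [conjMoment]
  rw [← integral_const_mul, ← integral_const_mul,
    ← integral_add ((h D).const_mul _) ((h D').const_mul _)]
  refine integral_mono (h _) (((h D).const_mul _).add ((h D').const_mul _)) fun U => ?_
  simp only [mul_add, Matrix.trace_add]
  set x := ((U : Matrix ι ι ℂ) * C * star (U : Matrix ι ι ℂ) * D).trace
  set y := ((U : Matrix ι ι ℂ) * C * star (U : Matrix ι ι ℂ) * D').trace
  nlinarith [norm_add_le x y, norm_nonneg (x + y), sq_nonneg (‖x‖ - ‖y‖), norm_nonneg x,
    norm_nonneg y]

variable [μ.IsMulLeftInvariant]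

/-- The spectral theorem and unitary invariance extend the diagonal formula to traceless Hermitian
matrices. -/
theorem conjMoment_of_isHermitian (C : Matrix ι ι ℂ) {q : ℝ}
    (hq : ∀ i j, i ≠ j →
      conjMoment μ C (Matrix.single i i 1 - Matrix.single j j 1) = q)
    {D : Matrix ι ι ℂ} (hD : D.IsHermitian) (htr : D.trace = 0) :
    conjMoment μ C D = q / 2 * hsSq D := by
  have hsp := hD.spectral_theorem
  rw [Unitary.conjStarAlgAut_apply] at hsp
  have hsum : ∑ i, hD.eigenvalues i = 0 := by
    have := hD.trace_eq_sum_eigenvalues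
    rw [htr] at this
    exact Complex.ofReal_eq_zero.1 (by push_cast; exact this.symm)
  have hhs : hsSq D = ∑ i, hD.eigenvalues i ^ 2 := by
    conv_lhs => rw [hsp]
    rw [hsSq_unitary_conj]
    refine Finset.sum_congr rfl fun i _ => ?_
    rw [Finset.sum_eq_single i]
    · simp
    · intro j _ hj; simp [Matrix.diagonal_apply_ne _ hj.symm]
    · simp
  rw [hhs, ← conjMoment_diagonal μ C hq _ hsum]
  conv_lhs => rw [hsp]
  exact conjMoment_unitary_conj μ C _ _

/-- The common value of `𝔼 |X_{ii} - X_{jj}|²`, for `X = U C U^*` and `i ≠ j`, is also that of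
`𝔼 |X_{ij} + X_{ji}|²`; summing the latter over all pairs bounds it by the norm of `C`. -/
theorem card_mul_le_of_conjMoment_eq (C : Matrix ι ι ℂ) {q : ℝ}
    (hq : ∀ i j, i ≠ j →
      conjMoment μ C (Matrix.single i i 1 - Matrix.single j j 1) = q) :
    (Fintype.card ι : ℝ) * (Fintype.card ι - 1) * q ≤ 4 * hsSq C := by
  have hS : ∀ i j : ι, i ≠ j →
      conjMoment μ C (Matrix.single i j 1 + Matrix.single j i 1) = q := by
    intro i j hij
    have hH : (Matrix.single i j (1 : ℂ) + Matrix.single j i 1).IsHermitian := by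
      rw [Matrix.IsHermitian, Matrix.conjTranspose_add]
      simp [add_comm]
    rw [conjMoment_of_isHermitian μ C hq hH (by simp [hij, hij.symm])]
    have : (hsSq (Matrix.single i j (1 : ℂ) + Matrix.single j i 1) : ℂ) = (2 : ℝ) := by
      rw [ofReal_hsSq, hH.eq]
      simp [mul_add, add_mul, hij, hij.symm]
      norm_num
    rw [show hsSq (Matrix.single i j (1 : ℂ) + Matrix.single j i 1) = 2 by exact_mod_cast this]
    ring
  have hle : ∀ i j : ι, (if i = j then 0 else q) ≤
      ∫ U : Matrix.unitaryGroup ι ℂ,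
        (2 * ‖((U : Matrix ι ι ℂ) * C * star (U : Matrix ι ι ℂ)) j i‖ ^ 2 +
         2 * ‖((U : Matrix ι ι ℂ) * C * star (U : Matrix ι ι ℂ)) i j‖ ^ 2) ∂μ := by
    intro i j
    split_ifs with h
    · exact integral_nonneg fun U => by positivity
    · rw [← hS i j h, conjMoment]
      refine integral_mono_of_nonneg (ae_of_all _ fun U => by positivity) ?_
        (ae_of_all _ fun U => ?_)
      · refine Continuous.integrable_of_compactSpace ?_ μ
        fun_prop
      · simp only [mul_add, Matrix.trace_add, Matrix.trace_mul_single, MulOpposite.op_one, one_smul]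
        have := parallelogram_law_with_norm ℝ
          (((U : Matrix ι ι ℂ) * C * star (U : Matrix ι ι ℂ)) j i)
          (((U : Matrix ι ι ℂ) * C * star (U : Matrix ι ι ℂ)) i j)
        nlinarith [sq_nonneg ‖((U : Matrix ι ι ℂ) * C * star (U : Matrix ι ι ℂ)) j i -
          ((U : Matrix ι ι ℂ) * C * star (U : Matrix ι ι ℂ)) i j‖]
  have hsum := Finset.sum_le_sum fun i (_ : i ∈ Finset.univ) =>
    Finset.sum_le_sum fun j (_ : j ∈ Finset.univ) => hle i j
  have hint : ∀ i j : ι, Integrable (fun U : Matrix.unitaryGroup ι ℂ =>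
        (2 * ‖((U : Matrix ι ι ℂ) * C * star (U : Matrix ι ι ℂ)) j i‖ ^ 2 +
         2 * ‖((U : Matrix ι ι ℂ) * C * star (U : Matrix ι ι ℂ)) i j‖ ^ 2)) μ := by
    intro i j
    refine Continuous.integrable_of_compactSpace ?_ μ
    fun_prop
  simp only [← integral_finsetSum _ fun j _ => hint _ j] at hsum
  rw [← integral_finsetSum _ fun i _ => integrable_finsetSum _ fun j _ => hint i j] at hsum
  have hR : ∀ U : Matrix.unitaryGroup ι ℂ, ∑ i, ∑ j,
        (2 * ‖((U : Matrix ι ι ℂ) * C * star (U : Matrix ι ι ℂ)) j i‖ ^ 2 +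
         2 * ‖((U : Matrix ι ι ℂ) * C * star (U : Matrix ι ι ℂ)) i j‖ ^ 2) = 4 * hsSq C := by
    intro U
    simp only [Finset.sum_add_distrib, ← Finset.mul_sum]
    rw [Finset.sum_comm, ← hsSq_unitary_conj U C, hsSq]
    ring
  simp only [hR] at hsum
  have hL : ∑ i : ι, ∑ j : ι, (if i = j then 0 else q) =
      (Fintype.card ι : ℝ) * (Fintype.card ι - 1) * q := by
    have : ∀ i j : ι, (if i = j then 0 else q) = q - if i = j then q else 0 := by
      intro i j; split_ifs <;> simp
    simp [this, Finset.sum_sub_distrib]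
    ring
  rw [hL] at hsum
  simpa using hsum

theorem card_sq_mul_conjMoment_le_of_trace_eq_zero (C D : Matrix ι ι ℂ) (htr : D.trace = 0) :
    (Fintype.card ι : ℝ) ^ 2 * conjMoment μ C D ≤ 8 * hsSq C * hsSq D := by
  have hC := hsSq_nonneg C
  rcases subsingleton_or_nontrivial ι with hι | hι
  · -- in dimension at most one a traceless matrix vanishes
    have : D = 0 := by
      ext i j
      obtain rfl := Subsingleton.elim i j
      simpa [Matrix.trace, Fintype.sum_subsingleton _ i] using htr
    simp [this, conjMoment, hsSq]
  obtain ⟨i₀, j₀, h₀⟩ := exists_pair_ne ι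
  set q := conjMoment μ C (Matrix.single i₀ i₀ 1 - Matrix.single j₀ j₀ 1) with hq_def
  have hq : ∀ i j, i ≠ j →
      conjMoment μ C (Matrix.single i i 1 - Matrix.single j j 1) = q := fun i j hij =>
    conjMoment_single_sub_single_eq μ C hij h₀
  have hq0 : 0 ≤ q := integral_nonneg fun U => by positivity
  have hN : (2 : ℝ) ≤ Fintype.card ι := by
    exact_mod_cast Fintype.one_lt_card
  have hqC : (Fintype.card ι : ℝ) ^ 2 * q ≤ 8 * hsSq C := by
    nlinarith [card_mul_le_of_conjMoment_eq μ C hq, mul_nonneg (mul_nonneg hq0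
      (by positivity : (0 : ℝ) ≤ Fintype.card ι)) (sub_nonneg.2 hN)]
  -- decompose into Hermitian parts: `D = H + i K`
  set H : Matrix ι ι ℂ := (1 / 2 : ℂ) • (D + D.conjTranspose) with hH
  set K : Matrix ι ι ℂ := (-Complex.I / 2) • (D - D.conjTranspose) with hK
  have hHh : H.IsHermitian := by
    rw [Matrix.IsHermitian, hH]
    simp [Matrix.conjTranspose_smul, add_comm]
  have hKh : K.IsHermitian := by
    rw [Matrix.IsHermitian, hK, Matrix.conjTranspose_smul]
    simp only [Matrix.conjTranspose_sub, Matrix.conjTranspose_conjTranspose, star_div₀, star_neg,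
      Complex.star_def, Complex.conj_I, neg_neg, Complex.conj_ofNat]
    rw [← neg_sub, smul_neg, ← neg_smul]
    congr 1
    ring
  have hDHK : D = H + Complex.I • K := by
    rw [hH, hK, smul_smul, show Complex.I * (-Complex.I / 2) = 1 / 2 by
      linear_combination (-1 / 2 : ℂ) * Complex.I_mul_I, ← smul_add]
    ext i j
    simp
    ring
  have hHtr : H.trace = 0 := by simp [hH, Matrix.trace_conjTranspose, htr]
  have hKtr : K.trace = 0 := by simp [hK, Matrix.trace_conjTranspose, htr]
  have hnorm : hsSq D = hsSq H + hsSq K := by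
    have : (hsSq D : ℂ) = ((hsSq H + hsSq K : ℝ) : ℂ) := by
      push_cast
      rw [ofReal_hsSq, ofReal_hsSq, ofReal_hsSq]
      conv_lhs => rw [hDHK]
      simp only [Matrix.conjTranspose_add, Matrix.conjTranspose_smul, hHh.eq, hKh.eq, mul_add,
        add_mul, Matrix.trace_add, Matrix.smul_mul, Matrix.mul_smul, Matrix.trace_smul,
        smul_eq_mul, Complex.star_def, Complex.conj_I, Matrix.trace_mul_comm K H]
      linear_combination (-(K * K).trace) * Complex.I_mul_I
    exact_mod_cast this
  have hmain : conjMoment μ C D ≤ q * hsSq D := by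
    calc conjMoment μ C D = conjMoment μ C (H + Complex.I • K) := by rw [← hDHK]
      _ ≤ 2 * conjMoment μ C H + 2 * conjMoment μ C (Complex.I • K) := conjMoment_add_le μ C _ _
      _ = q * hsSq D := by
        rw [conjMoment_of_isHermitian μ C hq hHh hHtr, conjMoment_smul μ Complex.I,
          conjMoment_of_isHermitian μ C hq hKh hKtr, hnorm, Complex.norm_I]
        ring
  calc (Fintype.card ι : ℝ) ^ 2 * conjMoment μ C D
      ≤ (Fintype.card ι : ℝ) ^ 2 * (q * hsSq D) := by gcongr
    _ = ((Fintype.card ι : ℝ) ^ 2 * q) * hsSq D := by ring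
    _ ≤ 8 * hsSq C * hsSq D := by
      gcongr
      exact hsSq_nonneg D

/-- Concentration of `Tr(U C U^* D)`, for a Haar unitary `U`, around its mean `Tr C Tr D / N`. -/
theorem card_sq_mul_integral_norm_trace_sub_sq_le (C D : Matrix ι ι ℂ) :
    (Fintype.card ι : ℝ) ^ 2 *
      ∫ U : Matrix.unitaryGroup ι ℂ, ‖((U : Matrix ι ι ℂ) * C * star (U : Matrix ι ι ℂ) * D).trace
        - C.trace * D.trace / Fintype.card ι‖ ^ 2 ∂μ ≤ 8 * hsSq C * hsSq D := by
  rcases isEmpty_or_nonempty ι with h | h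
  · simp [hsSq]
  set D' := D - (D.trace / Fintype.card ι) • (1 : Matrix ι ι ℂ) with hD'
  have hN : (Fintype.card ι : ℂ) ≠ 0 := by simp
  have htr : D'.trace = 0 := by
    simp [hD', hN]
  have hpt : ∀ U : Matrix.unitaryGroup ι ℂ,
      ((U : Matrix ι ι ℂ) * C * star (U : Matrix ι ι ℂ) * D).trace
        - C.trace * D.trace / Fintype.card ι =
      ((U : Matrix ι ι ℂ) * C * star (U : Matrix ι ι ℂ) * D').trace := by
    intro U
    have hU : ((U : Matrix ι ι ℂ) * C * star (U : Matrix ι ι ℂ)).trace = C.trace := by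
      rw [Matrix.trace_mul_cycle, Unitary.coe_star_mul_self, Matrix.one_mul]
    rw [hD', mul_sub, Matrix.trace_sub, Matrix.mul_smul, Matrix.trace_smul, Matrix.mul_one, hU,
      smul_eq_mul]
    ring
  simp only [hpt]
  refine (card_sq_mul_conjMoment_le_of_trace_eq_zero μ C D' htr).trans ?_
  have hC := hsSq_nonneg C
  gcongr
  exact hsSq_sub_trace_smul_one_le D

end ConjMoment

/-! ### Rank-one projections -/

section RankOne

variable {k : ℕ} {Y : Matrix (Fin k) (Fin k) ℂ}

theorem exists_eq_mul_star_of_rank_eq_one (hY : IsStarProjection Y) (hr : Y.rank = 1) :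
    ∃ y : Fin k → ℂ, (∀ i j, Y i j = y i * star (y j)) ∧ ∑ i, ‖y i‖ ^ 2 = 1 := by
  have hYh : Y.conjTranspose = Y := hY.isSelfAdjoint
  have hYY : Y * Y = Y := hY.isIdempotentElem
  obtain ⟨v, -, hv⟩ := finrank_eq_one_iff'.1 (show Module.finrank ℂ Y.mulVecLin.range = 1 from hr)
  have hcol : ∀ j, ∃ c : ℂ, ∀ i, Y i j = c * (v : Fin k → ℂ) i := by
    intro j
    obtain ⟨c, hc⟩ := hv ⟨Y.mulVecLin (Pi.single j 1), LinearMap.mem_range_self _ _⟩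
    refine ⟨c, fun i => ?_⟩
    have := congrFun (congrArg Subtype.val hc) i
    simpa using this.symm
  choose c hc using hcol
  set s : ℝ := ∑ l, ‖c l‖ ^ 2 with hs
  have hs0 : 0 ≤ s := Finset.sum_nonneg fun _ _ => by positivity
  have hYs : ∀ i j, Y i j = s * ((v : Fin k → ℂ) i * star ((v : Fin k → ℂ) j)) := by
    intro i j
    have h1 : Y i j = (Y * Y.conjTranspose) i j := by rw [hYh, hYY]
    rw [h1, Matrix.mul_apply, hs]
    push_cast
    rw [Finset.sum_mul]
    refine Finset.sum_congr rfl fun l _ => ?_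
    rw [Matrix.conjTranspose_apply, hc, hc, ← Complex.conj_mul', star_mul', Complex.star_def]
    ring
  set y : Fin k → ℂ := fun i => (Real.sqrt s : ℂ) * (v : Fin k → ℂ) i with hy
  have hYy : ∀ i j, Y i j = y i * star (y j) := by
    intro i j
    have hsq : (Real.sqrt s : ℂ) * Real.sqrt s = s := by
      exact_mod_cast Real.mul_self_sqrt hs0
    rw [hYs, hy]
    simp only [star_mul', Complex.star_def, Complex.conj_ofReal]
    rw [← hsq]
    ring
  refine ⟨y, hYy, ?_⟩
  have hY0 : Y ≠ 0 := by
    rintro rfl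
    simp at hr
  obtain ⟨i, j, hij⟩ : ∃ i j, Y i j ≠ 0 := by
    by_contra! h
    exact hY0 (Matrix.ext h)
  have h2 : Y i j = ((∑ l, ‖y l‖ ^ 2 : ℝ) : ℂ) * Y i j := by
    conv_lhs => rw [← hYY, Matrix.mul_apply]
    push_cast
    rw [Finset.sum_mul]
    refine Finset.sum_congr rfl fun l _ => ?_
    rw [hYy, hYy, hYy, ← Complex.conj_mul', Complex.star_def]
    ring
  have h3 : ((∑ l, ‖y l‖ ^ 2 : ℝ) : ℂ) = 1 := by
    apply mul_right_cancel₀ hij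
    rw [one_mul]
    exact h2.symm
  exact_mod_cast h3

theorem trace_eq_one_of_rank_eq_one (hY : IsStarProjection Y) (hr : Y.rank = 1) :
    Y.trace = 1 := by
  obtain ⟨y, hy, hy1⟩ := exists_eq_mul_star_of_rank_eq_one hY hr
  have : Y.trace = ((∑ i, ‖y i‖ ^ 2 : ℝ) : ℂ) := by
    push_cast
    exact Finset.sum_congr rfl fun i _ => by
      rw [Matrix.diag_apply, hy, ← Complex.mul_conj', Complex.star_def]
  rw [this, hy1, Complex.ofReal_one]

theorem hsSq_eq_one_of_rank_eq_one (hY : IsStarProjection Y) (hr : Y.rank = 1) :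
    hsSq Y = 1 := by
  have hYh : Y.conjTranspose = Y := hY.isSelfAdjoint
  have : (hsSq Y : ℂ) = (1 : ℝ) := by
    rw [ofReal_hsSq, hYh, hY.isIdempotentElem.eq, trace_eq_one_of_rank_eq_one hY hr,
      Complex.ofReal_one]
  exact_mod_cast this

end RankOne

/-! ### Concentration for a pair of channels applied to the Bell state -/

section BellPairing

variable {n k : ℕ}

/-- The matrix `(Tr(U (e_{ij} ⊗ Y) U^* D))_{ij}`, which encodes the linear functional
`X ↦ Tr(U (X ⊗ Y) U^* D)`. -/
noncomputable def channelPairing (Y : Matrix (Fin k) (Fin k) ℂ)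
    (D : Matrix (Fin n × Fin k) (Fin n × Fin k) ℂ) (U : Matrix.unitaryGroup (Fin n × Fin k) ℂ) :
    Matrix (Fin n) (Fin n) ℂ :=
  fun i j => ((U : Matrix (Fin n × Fin k) (Fin n × Fin k) ℂ) * (Matrix.single i j 1 ⊗ₖ Y) *
    star (U : Matrix (Fin n × Fin k) (Fin n × Fin k) ℂ) * D).trace

/-- The value on the Bell state of the product of the functionals `X ↦ Tr(U (X ⊗ Y₁) U^* D₁)` and
`X ↦ Tr(V (X ⊗ Y₂) V^* D₂)`. The entries of the output state, and those of its environment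
counterpart, are of this form. -/
noncomputable def bellPairing (Y₁ Y₂ : Matrix (Fin k) (Fin k) ℂ)
    (D₁ D₂ : Matrix (Fin n × Fin k) (Fin n × Fin k) ℂ)
    (U V : Matrix.unitaryGroup (Fin n × Fin k) ℂ) : ℂ :=
  (n : ℂ)⁻¹ * ∑ i, ∑ j, channelPairing Y₁ D₁ U i j * channelPairing Y₂ D₂ V i j

theorem continuous_channelPairing (Y : Matrix (Fin k) (Fin k) ℂ)
    (D : Matrix (Fin n × Fin k) (Fin n × Fin k) ℂ) (i j : Fin n) :
    Continuous fun U => channelPairing Y D U i j :=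
  continuous_trace_unitary_conj_mul _ _

theorem continuous_bellPairing (Y₁ Y₂ : Matrix (Fin k) (Fin k) ℂ)
    (D₁ D₂ : Matrix (Fin n × Fin k) (Fin n × Fin k) ℂ) :
    Continuous fun p : Matrix.unitaryGroup (Fin n × Fin k) ℂ ×
      Matrix.unitaryGroup (Fin n × Fin k) ℂ => bellPairing Y₁ Y₂ D₁ D₂ p.1 p.2 := by
  refine continuous_const.mul (continuous_finsetSum _ fun i _ => continuous_finsetSum _ fun j _ => ?_)
  exact ((continuous_channelPairing Y₁ D₁ i j).comp continuous_fst).mul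
    ((continuous_channelPairing Y₂ D₂ i j).comp continuous_snd)

theorem sum_channelPairing_mul (Y : Matrix (Fin k) (Fin k) ℂ)
    (D : Matrix (Fin n × Fin k) (Fin n × Fin k) ℂ) (U : Matrix.unitaryGroup (Fin n × Fin k) ℂ)
    (c : Matrix (Fin n) (Fin n) ℂ) :
    ∑ i, ∑ j, channelPairing Y D U i j * c i j =
      ((U : Matrix (Fin n × Fin k) (Fin n × Fin k) ℂ) * (c ⊗ₖ Y) *
        star (U : Matrix (Fin n × Fin k) (Fin n × Fin k) ℂ) * D).trace := by
  have hc : c ⊗ₖ Y = ∑ i, ∑ j, c i j • (Matrix.single i j (1 : ℂ) ⊗ₖ Y) := by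
    ext ⟨i, a⟩ ⟨j, b⟩
    conv_lhs => rw [Matrix.matrix_eq_sum_single c]
    simp only [Matrix.sum_apply, Matrix.smul_apply, Matrix.kroneckerMap_apply, smul_eq_mul,
      Finset.sum_mul, Matrix.single_apply]
    refine Finset.sum_congr rfl fun x _ => Finset.sum_congr rfl fun z _ => ?_
    split_ifs <;> ring
  simp only [hc, Matrix.mul_sum, Matrix.sum_mul, Matrix.trace_sum, Matrix.mul_smul,
    Matrix.smul_mul, Matrix.trace_smul, smul_eq_mul, channelPairing]
  exact Finset.sum_congr rfl fun i _ => Finset.sum_congr rfl fun j _ => mul_comm _ _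

theorem trace_channelPairing (Y : Matrix (Fin k) (Fin k) ℂ)
    (D : Matrix (Fin n × Fin k) (Fin n × Fin k) ℂ) (U : Matrix.unitaryGroup (Fin n × Fin k) ℂ) :
    (channelPairing Y D U).trace =
      ((U : Matrix (Fin n × Fin k) (Fin n × Fin k) ℂ) * (1 ⊗ₖ Y) *
        star (U : Matrix (Fin n × Fin k) (Fin n × Fin k) ℂ) * D).trace := by
  rw [← sum_channelPairing_mul]
  simp [Matrix.trace, Matrix.one_apply]

/-- Bessel's inequality for the orthogonal family `e_{ij} ⊗ Y`. -/
theorem sum_norm_trace_single_kronecker_mul_sq_le (Y : Matrix (Fin k) (Fin k) ℂ)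
    (M : Matrix (Fin n × Fin k) (Fin n × Fin k) ℂ) :
    ∑ i, ∑ j, ‖((Matrix.single i j 1 ⊗ₖ Y) * M).trace‖ ^ 2 ≤ hsSq Y * hsSq M := by
  have hpt : ∀ i j, ((Matrix.single i j 1 ⊗ₖ Y) * M).trace =
      ∑ c, ∑ d, Y c d * M (j, d) (i, c) := by
    intro i j
    simp only [Matrix.trace, Matrix.diag_apply, Matrix.mul_apply, Matrix.kroneckerMap_apply,
      Fintype.sum_prod_type]
    rw [Finset.sum_eq_single i]
    · refine Finset.sum_congr rfl fun c _ => ?_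
      rw [Finset.sum_eq_single j]
      · simp
      · intro b _ hb; simp [hb.symm]
      · simp
    · intro b _ hb; simp [hb.symm]
    · simp
  have hM : hsSq M = ∑ i, ∑ j, ∑ c, ∑ d, ‖M (j, d) (i, c)‖ ^ 2 := by
    simp only [hsSq, Fintype.sum_prod_type]
    conv_rhs => rw [Finset.sum_comm]
    refine Finset.sum_congr rfl fun j _ => ?_
    rw [Finset.sum_comm]
    refine Finset.sum_congr rfl fun i _ => ?_
    exact Finset.sum_comm
  rw [hM]
  simp only [Finset.mul_sum (a := hsSq Y), hpt]
  refine Finset.sum_le_sum fun i _ => Finset.sum_le_sum fun j _ => ?_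
  refine (norm_sum_mul_sq_le _ _).trans_eq ?_
  simp only [hsSq, Finset.mul_sum]

/-- Up to transposition, `channelPairing Y D U` is the compression of `U^* D U` to the copy
`ℂⁿ ⊗ range Y` of `ℂⁿ`. When `D` does not increase the Hilbert–Schmidt norm, its norm is therefore
at most that of the identity of `ℂⁿ`. -/
theorem hsSq_channelPairing_le {Y : Matrix (Fin k) (Fin k) ℂ} (hY : IsStarProjection Y)
    (hr : Y.rank = 1) {D : Matrix (Fin n × Fin k) (Fin n × Fin k) ℂ}
    (hD : ∀ X : Matrix (Fin n × Fin k) (Fin n × Fin k) ℂ, hsSq (D * X) ≤ hsSq X)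
    (U : Matrix.unitaryGroup (Fin n × Fin k) ℂ) :
    hsSq (channelPairing Y D U) ≤ n := by
  set u := (U : Matrix (Fin n × Fin k) (Fin n × Fin k) ℂ) with hu
  set J : Matrix (Fin n × Fin k) (Fin n × Fin k) ℂ := 1 ⊗ₖ Y with hJ
  have hY1 := hsSq_eq_one_of_rank_eq_one hY hr
  have hpt : ∀ i j, channelPairing Y D U i j =
      ((Matrix.single i j 1 ⊗ₖ Y) * (star u * (D * (u * J)))).trace := by
    intro i j
    have h1 : (Matrix.single i j (1 : ℂ) ⊗ₖ Y) = J * (Matrix.single i j 1 ⊗ₖ Y) := by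
      rw [hJ, ← Matrix.mul_kronecker_mul, Matrix.one_mul, hY.isIdempotentElem.eq]
    rw [channelPairing, h1, ← hu, Matrix.mul_assoc, Matrix.mul_assoc u, Matrix.mul_assoc J,
      ← Matrix.mul_assoc u, Matrix.trace_mul_comm, ← h1]
    simp only [Matrix.mul_assoc]
  calc hsSq (channelPairing Y D U)
      ≤ hsSq Y * hsSq (star u * (D * (u * J))) := by
        rw [hsSq]
        simp only [hpt]
        exact sum_norm_trace_single_kronecker_mul_sq_le _ _
    _ = hsSq (D * (u * J)) := by
        rw [hY1, one_mul]
        exact hsSq_unitary_mul (star U) _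
    _ ≤ hsSq (u * J) := hD _
    _ = hsSq J := hsSq_unitary_mul U _
    _ = n := by rw [hJ, hsSq_kronecker, hY1, hsSq_one]; simp

theorem norm_bellPairing_le {Y₁ Y₂ : Matrix (Fin k) (Fin k) ℂ} (hY₁ : IsStarProjection Y₁)
    (hY₂ : IsStarProjection Y₂) (hr₁ : Y₁.rank = 1) (hr₂ : Y₂.rank = 1)
    {D₁ D₂ : Matrix (Fin n × Fin k) (Fin n × Fin k) ℂ}
    (hD₁ : ∀ X : Matrix (Fin n × Fin k) (Fin n × Fin k) ℂ, hsSq (D₁ * X) ≤ hsSq X)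
    (hD₂ : ∀ X : Matrix (Fin n × Fin k) (Fin n × Fin k) ℂ, hsSq (D₂ * X) ≤ hsSq X)
    (U V : Matrix.unitaryGroup (Fin n × Fin k) ℂ) :
    ‖bellPairing Y₁ Y₂ D₁ D₂ U V‖ ≤ 1 := by
  rcases Nat.eq_zero_or_pos n with rfl | hn
  · simp [bellPairing]
  have h := norm_sum_mul_sq_le (channelPairing Y₁ D₁ U) (channelPairing Y₂ D₂ V)
  have h₁ := hsSq_channelPairing_le hY₁ hr₁ hD₁ U
  have h₂ := hsSq_channelPairing_le hY₂ hr₂ hD₂ V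
  have hn' : (0 : ℝ) < n := by exact_mod_cast hn
  have h3 : ‖∑ i, ∑ j, channelPairing Y₁ D₁ U i j * channelPairing Y₂ D₂ V i j‖ ^ 2 ≤
      (n : ℝ) ^ 2 := by
    rw [pow_two (n : ℝ)]
    exact h.trans (mul_le_mul h₁ h₂ (hsSq_nonneg _) hn'.le)
  rw [bellPairing, norm_mul, norm_inv, Complex.norm_natCast, inv_mul_le_iff₀ hn', mul_one]
  exact le_of_sq_le_sq h3 hn'.le

/-- If `f (·, b)` is close to `m b` in mean square for every `b`, and `m` is close to `z` in mean
square, then `f` is close to `z` in mean square. It is used with `m b` the mean of `f (·, b)`. -/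
theorem integral_prod_norm_sub_sq_le {α β : Type*} [TopologicalSpace α] [TopologicalSpace β]
    [CompactSpace α] [CompactSpace β] [MeasurableSpace α] [MeasurableSpace β]
    [OpensMeasurableSpace α] [OpensMeasurableSpace β] [SecondCountableTopology α]
    [SecondCountableTopology β] (μ : Measure α) (ν : Measure β) [IsProbabilityMeasure μ]
    [IsProbabilityMeasure ν] {f : α × β → ℂ} (hf : Continuous f) {m : β → ℂ} (hm : Continuous m)
    (z : ℂ) {B : ℝ} (h₁ : ∀ b, ∫ a, ‖f (a, b) - m b‖ ^ 2 ∂μ ≤ B)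
    (h₂ : ∫ b, ‖m b - z‖ ^ 2 ∂ν ≤ B) :
    ∫ p, ‖f p - z‖ ^ 2 ∂(μ.prod ν) ≤ 4 * B := by
  have hint₁ : Integrable (fun p : α × β => ‖f p - m p.2‖ ^ 2) (μ.prod ν) :=
    Continuous.integrable_of_compactSpace (by fun_prop) _
  have hint₂ : Integrable (fun p : α × β => ‖m p.2 - z‖ ^ 2) (μ.prod ν) :=
    Continuous.integrable_of_compactSpace (by fun_prop) _
  have hint : Integrable (fun p : α × β => ‖f p - z‖ ^ 2) (μ.prod ν) :=
    Continuous.integrable_of_compactSpace (by fun_prop) _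
  have hint₃ : Integrable (fun b => ∫ a, ‖f (a, b) - m b‖ ^ 2 ∂μ) ν := hint₁.integral_prod_right
  have e₁ : ∫ p : α × β, ‖f p - m p.2‖ ^ 2 ∂(μ.prod ν) ≤ B := by
    rw [integral_prod_symm _ hint₁]
    calc ∫ b, ∫ a, ‖f (a, b) - m b‖ ^ 2 ∂μ ∂ν ≤ ∫ _ : β, B ∂ν :=
          integral_mono hint₃ (integrable_const _) h₁
      _ = B := by simp
  have e₂ : ∫ p : α × β, ‖m p.2 - z‖ ^ 2 ∂(μ.prod ν) ≤ B := by
    rw [integral_prod_symm _ hint₂]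
    simpa using h₂
  calc ∫ p, ‖f p - z‖ ^ 2 ∂(μ.prod ν)
      ≤ ∫ p : α × β, (2 * ‖f p - m p.2‖ ^ 2 + 2 * ‖m p.2 - z‖ ^ 2) ∂(μ.prod ν) := by
        refine integral_mono hint ((hint₁.const_mul 2).add (hint₂.const_mul 2)) fun p => ?_
        nlinarith [norm_sub_le_norm_sub_add_norm_sub (f p) (m p.2) z, norm_nonneg (f p - z),
          sq_nonneg (‖f p - m p.2‖ - ‖m p.2 - z‖), norm_nonneg (f p - m p.2),
          norm_nonneg (m p.2 - z)]
    _ = 2 * ∫ p : α × β, ‖f p - m p.2‖ ^ 2 ∂(μ.prod ν) +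
        2 * ∫ p : α × β, ‖m p.2 - z‖ ^ 2 ∂(μ.prod ν) := by
        rw [integral_add (hint₁.const_mul 2) (hint₂.const_mul 2), integral_const_mul,
          integral_const_mul]
    _ ≤ 4 * B := by linarith

/-- Concentration of `bellPairing` around its mean for independent Haar unitaries. Conditionally on
`V`, it is of the form `Tr(U C U^* D₁) / n` where `Tr C` has itself the form `Tr(V C' V^* D₂)`, so
the estimate for a single random conjugation is applied twice. -/
theorem integral_norm_bellPairing_sub_sq_le (hn : 1 ≤ n) (hk : 1 ≤ k)
    {Y₁ Y₂ : Matrix (Fin k) (Fin k) ℂ} (hY₁ : IsStarProjection Y₁)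
    (hY₂ : IsStarProjection Y₂) (hr₁ : Y₁.rank = 1) (hr₂ : Y₂.rank = 1)
    {D₁ D₂ : Matrix (Fin n × Fin k) (Fin n × Fin k) ℂ}
    (hD₁ : ∀ X : Matrix (Fin n × Fin k) (Fin n × Fin k) ℂ, hsSq (D₁ * X) ≤ hsSq X)
    (hD₂ : ∀ X : Matrix (Fin n × Fin k) (Fin n × Fin k) ℂ, hsSq (D₂ * X) ≤ hsSq X)
    {d : ℝ} (hd₁ : hsSq D₁ ≤ d) (hd₂ : hsSq D₂ ≤ d)
    (μ ν : Measure (Matrix.unitaryGroup (Fin n × Fin k) ℂ)) [IsProbabilityMeasure μ]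
    [IsProbabilityMeasure ν] [μ.IsMulLeftInvariant] [ν.IsMulLeftInvariant] :
    ∫ p, ‖bellPairing Y₁ Y₂ D₁ D₂ p.1 p.2 - D₁.trace * D₂.trace / ((n : ℂ) * k) ^ 2‖ ^ 2
      ∂(μ.prod ν) ≤ 32 * d / (n * ((n : ℝ) * k) ^ 2) := by
  have hn0 : (0 : ℝ) < n := by exact_mod_cast hn
  have hk0 : (0 : ℝ) < k := by exact_mod_cast hk
  have hnC : (n : ℂ) ≠ 0 := by exact_mod_cast hn0.ne'
  have hkC : (k : ℂ) ≠ 0 := by exact_mod_cast hk0.ne'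
  have hd0 : 0 ≤ d := (hsSq_nonneg _).trans hd₁
  have hcard : (Fintype.card (Fin n × Fin k) : ℝ) = n * k := by simp
  have hcardC : (Fintype.card (Fin n × Fin k) : ℂ) = n * k := by simp
  set B : ℝ := 8 * d / (n * ((n : ℝ) * k) ^ 2) with hB
  have harith : ∀ {I : ℝ}, ((n : ℝ) * k) ^ 2 * I ≤ 8 * n * d → (n : ℝ)⁻¹ ^ 2 * I ≤ B := by
    intro I hI
    rw [hB, le_div_iff₀ (by positivity)]
    calc (n : ℝ)⁻¹ ^ 2 * I * (n * ((n : ℝ) * k) ^ 2)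
        = (n : ℝ)⁻¹ * (((n : ℝ) * k) ^ 2 * I) := by field_simp
      _ ≤ (n : ℝ)⁻¹ * (8 * n * d) := by gcongr
      _ = 8 * d := by field_simp
  -- the error term of the inner integration
  have hU : ∀ V, ∫ U, ‖bellPairing Y₁ Y₂ D₁ D₂ U V -
      (n : ℂ)⁻¹ * ((channelPairing Y₂ D₂ V).trace * D₁.trace / (n * k))‖ ^ 2 ∂μ ≤ B := by
    intro V
    have h := card_sq_mul_integral_norm_trace_sub_sq_le μ (channelPairing Y₂ D₂ V ⊗ₖ Y₁) D₁
    rw [hsSq_kronecker, hsSq_eq_one_of_rank_eq_one hY₁ hr₁, mul_one, Matrix.trace_kronecker,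
      trace_eq_one_of_rank_eq_one hY₁ hr₁, mul_one, hcard, hcardC] at h
    simp only [bellPairing, sum_channelPairing_mul, ← mul_sub, norm_mul, mul_pow,
      integral_const_mul, norm_inv, Complex.norm_natCast]
    refine harith (h.trans ?_)
    have := hsSq_channelPairing_le hY₂ hr₂ hD₂ V
    gcongr
    exact hsSq_nonneg _
  -- the error term of the outer integration
  have hD₁tr : ‖D₁.trace‖ ≤ n * k := by
    have h := norm_trace_mul_sq_le (1 : Matrix (Fin n × Fin k) (Fin n × Fin k) ℂ) D₁
    have h' := hD₁ 1
    rw [Matrix.mul_one, hsSq_one, hcard] at h'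
    rw [Matrix.one_mul, hsSq_one, hcard] at h
    refine le_of_sq_le_sq (h.trans ?_) (by positivity)
    rw [pow_two]
    gcongr
  have hV : ∫ V, ‖(n : ℂ)⁻¹ * ((channelPairing Y₂ D₂ V).trace * D₁.trace / (n * k)) -
      D₁.trace * D₂.trace / ((n : ℂ) * k) ^ 2‖ ^ 2 ∂ν ≤ B := by
    have h := card_sq_mul_integral_norm_trace_sub_sq_le ν
      ((1 : Matrix (Fin n) (Fin n) ℂ) ⊗ₖ Y₂) D₂
    rw [hsSq_kronecker, hsSq_eq_one_of_rank_eq_one hY₂ hr₂, mul_one, Matrix.trace_kronecker,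
      trace_eq_one_of_rank_eq_one hY₂ hr₂, mul_one, hcard, hcardC, hsSq_one, Matrix.trace_one,
      Fintype.card_fin] at h
    have hpt : ∀ V, (n : ℂ)⁻¹ * ((channelPairing Y₂ D₂ V).trace * D₁.trace / (n * k)) -
        D₁.trace * D₂.trace / ((n : ℂ) * k) ^ 2 = ((n : ℂ)⁻¹ * (D₁.trace / (n * k))) *
          ((channelPairing Y₂ D₂ V).trace - n * D₂.trace / (n * k)) := by
      intro V
      field_simp
    have hc : ‖(n : ℂ)⁻¹ * (D₁.trace / (n * k))‖ ≤ (n : ℝ)⁻¹ := by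
      rw [norm_mul, norm_div, norm_mul, norm_inv, Complex.norm_natCast, Complex.norm_natCast]
      refine mul_le_of_le_one_right (by positivity) ?_
      rw [div_le_one (by positivity)]
      exact hD₁tr
    rw [funext fun V => congrArg (fun z : ℂ => ‖z‖ ^ 2) (hpt V)]
    simp only [norm_mul _ (_ - _), mul_pow, integral_const_mul]
    refine le_trans ?_ (harith (h.trans (by gcongr)))
    simp only [trace_channelPairing]
    gcongr
  refine (integral_prod_norm_sub_sq_le μ ν (continuous_bellPairing Y₁ Y₂ D₁ D₂)
    (m := fun V => (n : ℂ)⁻¹ * ((channelPairing Y₂ D₂ V).trace * D₁.trace / (n * k)))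
    ?_ _ hU hV).trans_eq (by rw [hB]; ring)
  have : Continuous fun V => (channelPairing Y₂ D₂ V).trace :=
    continuous_finsetSum _ fun i _ => continuous_channelPairing Y₂ D₂ i i
  fun_prop

end BellPairing

/-! ### The output state and its Gram matrix -/

section OutputState

variable {n k : ℕ}

theorem trace_mul_single_kronecker_one (M : Matrix (Fin n × Fin k) (Fin n × Fin k) ℂ)
    (r s : Fin n) :
    (M * (Matrix.single s r 1 ⊗ₖ 1)).trace = ∑ a, M (r, a) (s, a) := by
  simp only [Matrix.trace, Matrix.diag_apply, Matrix.mul_apply, Matrix.kroneckerMap_apply,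
    Fintype.sum_prod_type, Matrix.one_apply]
  rw [Finset.sum_eq_single r]
  · refine Finset.sum_congr rfl fun a _ => ?_
    rw [Finset.sum_eq_single s]
    · simp
    · intro b _ hb; simp [hb.symm]
    · simp
  · intro b _ hb; simp [hb.symm]
  · simp

theorem trace_mul_one_kronecker_single (M : Matrix (Fin n × Fin k) (Fin n × Fin k) ℂ)
    (a c : Fin k) :
    (M * (1 ⊗ₖ Matrix.single a c 1)).trace = ∑ r, M (r, c) (r, a) := by
  simp only [Matrix.trace, Matrix.diag_apply, Matrix.mul_apply, Matrix.kroneckerMap_apply,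
    Fintype.sum_prod_type, Matrix.one_apply]
  refine Finset.sum_congr rfl fun r _ => ?_
  rw [Finset.sum_eq_single c]
  · rw [Finset.sum_eq_single r]
    · rw [Finset.sum_eq_single a]
      · simp
      · intro b _ hb; simp [hb.symm]
      · simp
    · intro b _ hb; simp [hb]
    · simp
  · intro b _ hb; simp [hb.symm]
  · simp

theorem hsSq_single_kronecker_one_mul_le (r s : Fin n)
    (X : Matrix (Fin n × Fin k) (Fin n × Fin k) ℂ) :
    hsSq ((Matrix.single s r (1 : ℂ) ⊗ₖ (1 : Matrix (Fin k) (Fin k) ℂ)) * X) ≤ hsSq X := by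
  have h : ∀ x a q, ((Matrix.single s r (1 : ℂ) ⊗ₖ (1 : Matrix (Fin k) (Fin k) ℂ)) * X) (x, a) q =
      if s = x then X (r, a) q else 0 := by
    intro x a q
    simp only [Matrix.mul_apply, Matrix.kroneckerMap_apply, Fintype.sum_prod_type]
    rw [Finset.sum_eq_single r]
    · simp [Matrix.single_apply, Matrix.one_apply]
    · intro b _ hb; simp [hb.symm]
    · simp
  rw [hsSq, hsSq, Fintype.sum_prod_type, Fintype.sum_prod_type]
  simp only [h]
  rw [Finset.sum_eq_single s]
  · simp only [if_true]
    exact Finset.single_le_sum (f := fun x => ∑ a, ∑ q, ‖X (x, a) q‖ ^ 2)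
      (fun x _ => by positivity) (Finset.mem_univ r)
  · intro b _ hb; simp [hb.symm]
  · simp

theorem hsSq_one_kronecker_single_mul_le (a c : Fin k)
    (X : Matrix (Fin n × Fin k) (Fin n × Fin k) ℂ) :
    hsSq (((1 : Matrix (Fin n) (Fin n) ℂ) ⊗ₖ Matrix.single a c (1 : ℂ)) * X) ≤ hsSq X := by
  have h : ∀ x b q, (((1 : Matrix (Fin n) (Fin n) ℂ) ⊗ₖ Matrix.single a c (1 : ℂ)) * X) (x, b) q =
      if a = b then X (x, c) q else 0 := by
    intro x b q
    simp only [Matrix.mul_apply, Matrix.kroneckerMap_apply, Fintype.sum_prod_type]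
    rw [Finset.sum_eq_single x]
    · simp [Matrix.single_apply, ite_and]
    · intro b _ hb; simp [hb.symm]
    · simp
  rw [hsSq, hsSq, Fintype.sum_prod_type, Fintype.sum_prod_type]
  simp only [h]
  refine Finset.sum_le_sum fun x _ => ?_
  rw [Finset.sum_eq_single a]
  · simp only [if_true]
    exact Finset.single_le_sum (f := fun b => ∑ q, ‖X (x, b) q‖ ^ 2)
      (fun x _ => by positivity) (Finset.mem_univ c)
  · intro b _ hb; simp [hb.symm]
  · simp

theorem channel_single_apply (Y : Matrix (Fin k) (Fin k) ℂ)
    (U : Matrix.unitaryGroup (Fin n × Fin k) ℂ) (i j r s : Fin n) :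
    channel Y U (Matrix.single i j 1) r s =
      channelPairing Y (Matrix.single s r 1 ⊗ₖ 1) U i j := by
  rw [channelPairing, trace_mul_single_kronecker_one]
  rfl

theorem bellState_apply (i r j s : Fin n) :
    bellState n (i, r) (j, s) = if i = r ∧ j = s then (n : ℂ)⁻¹ else 0 := by
  simp only [bellState, Matrix.smul_apply, Matrix.sum_apply, Matrix.kroneckerMap_apply,
    Matrix.single_apply, smul_eq_mul]
  rw [Finset.sum_eq_single i, Finset.sum_eq_single j]
  · by_cases h : i = r ∧ j = s <;> simp [h]
  · intro b _ hb; simp [hb]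
  · simp
  · intro b _ hb; simp [hb]
  · simp

theorem outputState_apply (Y₁ Y₂ : Matrix (Fin k) (Fin k) ℂ)
    (U V : Matrix.unitaryGroup (Fin n × Fin k) ℂ) (p q : Fin n × Fin n) :
    outputState Y₁ Y₂ U V p q = bellPairing Y₁ Y₂ (Matrix.single q.1 p.1 1 ⊗ₖ 1)
      (Matrix.single q.2 p.2 1 ⊗ₖ 1) U V := by
  simp only [outputState, tensorMap, bellState_apply, Matrix.sum_apply, Matrix.smul_apply,
    Matrix.kroneckerMap_apply, channel_single_apply, bellPairing, Finset.mul_sum, smul_eq_mul]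
  refine Finset.sum_congr rfl fun i _ => Finset.sum_congr rfl fun j _ => ?_
  rw [Finset.sum_eq_single i, Finset.sum_eq_single j]
  · simp
  · intro b _ hb; simp [hb.symm]
  · simp
  · intro b _ hb; simp [hb.symm]
  · simp

theorem continuous_outputState (Y₁ Y₂ : Matrix (Fin k) (Fin k) ℂ) :
    Continuous fun p : Matrix.unitaryGroup (Fin n × Fin k) ℂ ×
      Matrix.unitaryGroup (Fin n × Fin k) ℂ => outputState Y₁ Y₂ p.1 p.2 :=
  continuous_matrix fun p q => by
    simp only [outputState_apply]
    exact continuous_bellPairing _ _ _ _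

/-- The matrix entry `A_a(r, i)` of the Kraus operator `A_a = (1 ⊗ ⟨a|) U (1 ⊗ |y⟩)` of the channel
attached to `U` and the projection on `y`. -/
noncomputable def krausEntry (y : Fin k → ℂ) (U : Matrix.unitaryGroup (Fin n × Fin k) ℂ) (a : Fin k)
    (r i : Fin n) : ℂ :=
  ∑ c, (U : Matrix (Fin n × Fin k) (Fin n × Fin k) ℂ) (r, a) (i, c) * y c

theorem unitary_conj_single_kronecker_apply {Y : Matrix (Fin k) (Fin k) ℂ} {y : Fin k → ℂ}
    (hy : ∀ i j, Y i j = y i * star (y j)) (U : Matrix.unitaryGroup (Fin n × Fin k) ℂ)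
    (i j r s : Fin n) (a b : Fin k) :
    ((U : Matrix (Fin n × Fin k) (Fin n × Fin k) ℂ) * (Matrix.single i j 1 ⊗ₖ Y) *
      star (U : Matrix (Fin n × Fin k) (Fin n × Fin k) ℂ) :
        Matrix (Fin n × Fin k) (Fin n × Fin k) ℂ) (r, a) (s, b) =
      krausEntry y U a r i * star (krausEntry y U b s j) := by
  have h : ∀ x d, ((U : Matrix (Fin n × Fin k) (Fin n × Fin k) ℂ) *
      (Matrix.single i j 1 ⊗ₖ Y) : Matrix (Fin n × Fin k) (Fin n × Fin k) ℂ) (r, a) (x, d) =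
      if j = x then krausEntry y U a r i * star (y d) else 0 := by
    intro x d
    simp only [Matrix.mul_apply, Matrix.kroneckerMap_apply, Fintype.sum_prod_type, hy]
    rw [Finset.sum_eq_single i]
    · simp only [Matrix.single_apply, true_and, krausEntry, Finset.sum_mul]
      split_ifs
      · exact Finset.sum_congr rfl fun c _ => by ring
      · simp
    · intro b _ hb; simp [hb.symm]
    · simp
  rw [Matrix.mul_apply, Fintype.sum_prod_type, Finset.sum_eq_single j]
  · simp only [h, if_true, Matrix.star_apply, krausEntry, star_sum, star_mul', Finset.mul_sum]
    exact Finset.sum_congr rfl fun c _ => by ring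
  · intro x _ hx; simp [h, hx.symm]
  · simp

/-- The `n² × k²` matrix whose columns are the vectors obtained by applying the Kraus operators
`A_a ⊗ B_b` to the Bell vector. -/
noncomputable def krausMatrix (y₁ y₂ : Fin k → ℂ) (U V : Matrix.unitaryGroup (Fin n × Fin k) ℂ) :
    Matrix (Fin n × Fin n) (Fin k × Fin k) ℂ :=
  fun p q => ((Real.sqrt n : ℝ) : ℂ)⁻¹ *
    ∑ i, krausEntry y₁ U q.1 p.1 i * krausEntry y₂ V q.2 p.2 i

theorem inv_sqrt_mul_star_inv_sqrt :
    ((Real.sqrt n : ℝ) : ℂ)⁻¹ * star ((Real.sqrt n : ℝ) : ℂ)⁻¹ = (n : ℂ)⁻¹ := by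
  rw [star_inv₀, Complex.star_def, Complex.conj_ofReal, ← mul_inv]
  congr 1
  exact_mod_cast Real.mul_self_sqrt (Nat.cast_nonneg n)

variable {Y₁ Y₂ : Matrix (Fin k) (Fin k) ℂ} {y₁ y₂ : Fin k → ℂ}

theorem outputState_eq_krausMatrix_mul_conjTranspose (hy₁ : ∀ i j, Y₁ i j = y₁ i * star (y₁ j))
    (hy₂ : ∀ i j, Y₂ i j = y₂ i * star (y₂ j)) (U V : Matrix.unitaryGroup (Fin n × Fin k) ℂ) :
    outputState Y₁ Y₂ U V = krausMatrix y₁ y₂ U V * (krausMatrix y₁ y₂ U V).conjTranspose := by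
  ext p q
  simp only [outputState_apply, bellPairing, channelPairing, trace_mul_single_kronecker_one,
    unitary_conj_single_kronecker_apply hy₁, unitary_conj_single_kronecker_apply hy₂,
    Matrix.mul_apply, Matrix.conjTranspose_apply, krausMatrix, star_mul', star_sum,
    ← inv_sqrt_mul_star_inv_sqrt (n := n)]
  simp only [Finset.mul_sum, Finset.sum_mul, Fintype.sum_prod_type]
  conv_rhs => rw [Finset.sum_comm]
  rw [Finset.sum_congr rfl fun i _ => Finset.sum_comm]
  rw [Finset.sum_comm]
  refine Finset.sum_congr rfl fun a _ => ?_
  rw [Finset.sum_congr rfl fun i _ => Finset.sum_comm]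
  rw [Finset.sum_comm]
  refine Finset.sum_congr rfl fun b _ => ?_
  rw [Finset.sum_comm]
  exact Finset.sum_congr rfl fun i _ => Finset.sum_congr rfl fun j _ => by ring

theorem conjTranspose_mul_krausMatrix_apply (hy₁ : ∀ i j, Y₁ i j = y₁ i * star (y₁ j))
    (hy₂ : ∀ i j, Y₂ i j = y₂ i * star (y₂ j)) (U V : Matrix.unitaryGroup (Fin n × Fin k) ℂ)
    (p q : Fin k × Fin k) :
    ((krausMatrix y₁ y₂ U V).conjTranspose * krausMatrix y₁ y₂ U V) p q =
      bellPairing Y₁ Y₂ (1 ⊗ₖ Matrix.single p.1 q.1 1) (1 ⊗ₖ Matrix.single p.2 q.2 1) U V := by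
  simp only [bellPairing, channelPairing, trace_mul_one_kronecker_single,
    unitary_conj_single_kronecker_apply hy₁, unitary_conj_single_kronecker_apply hy₂,
    Matrix.mul_apply, Matrix.conjTranspose_apply, krausMatrix, star_mul', star_sum,
    ← inv_sqrt_mul_star_inv_sqrt (n := n)]
  simp only [Finset.mul_sum, Finset.sum_mul, Fintype.sum_prod_type]
  symm
  conv_rhs => rw [Finset.sum_comm]
  rw [Finset.sum_congr rfl fun i _ => Finset.sum_comm]
  rw [Finset.sum_comm]
  refine Finset.sum_congr rfl fun a _ => ?_
  rw [Finset.sum_congr rfl fun i _ => Finset.sum_comm]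
  rw [Finset.sum_comm]
  refine Finset.sum_congr rfl fun b _ => ?_
  exact Finset.sum_congr rfl fun i _ => Finset.sum_congr rfl fun j _ => by ring

end OutputState

/-! ### Operator norm and eigenvalues -/

section OpNorm

variable {ι : Type*} [Fintype ι] [DecidableEq ι]

theorem opNorm_sq_le_hsSq (A : Matrix ι ι ℂ) : opNorm A ^ 2 ≤ hsSq A := by
  have h : opNorm A ≤ Real.sqrt (hsSq A) := by
    refine ContinuousLinearMap.opNorm_le_bound _ (Real.sqrt_nonneg _) fun x => ?_
    refine (Real.le_sqrt_of_sq_le (y := hsSq A * ‖x‖ ^ 2) ?_).trans_eq ?_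
    · rw [EuclideanSpace.norm_sq_eq, EuclideanSpace.norm_sq_eq, hsSq, Finset.sum_mul]
      refine Finset.sum_le_sum fun i _ => ?_
      have : (Matrix.toEuclideanCLM (𝕜 := ℂ) A x) i = ∑ j, A i j * x j := rfl
      rw [this]
      calc ‖∑ j, A i j * x j‖ ^ 2 ≤ (∑ j, ‖A i j‖ * ‖x j‖) ^ 2 := by
            gcongr
            exact (norm_sum_le _ _).trans_eq (by simp only [norm_mul])
        _ ≤ _ := Finset.sum_mul_sq_le_sq_mul_sq _ _ _
    · rw [Real.sqrt_mul (hsSq_nonneg A), Real.sqrt_sq (norm_nonneg x)]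
  calc opNorm A ^ 2 ≤ Real.sqrt (hsSq A) ^ 2 := by
        gcongr
        exact norm_nonneg _
    _ = hsSq A := Real.sq_sqrt (hsSq_nonneg A)

/-- An eigenvalue of `M` is as close to `c` as `M` is to the scalar matrix `c`. -/
theorem norm_sub_le_opNorm_of_mulVec_eq {M : Matrix ι ι ℂ} {v : ι → ℂ} {z : ℂ} (hv : v ≠ 0)
    (h : M.mulVec v = z • v) (c : ℂ) : ‖z - c‖ ≤ opNorm (M - c • (1 : Matrix ι ι ℂ)) := by
  set x : EuclideanSpace ℂ ι := WithLp.toLp 2 v with hx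
  have hx0 : x ≠ 0 := by simpa [hx] using hv
  have h1 : Matrix.toEuclideanCLM (𝕜 := ℂ) (M - c • (1 : Matrix ι ι ℂ)) x = (z - c) • x := by
    rw [hx, Matrix.toEuclideanCLM_toLp, Matrix.sub_mulVec, h, Matrix.smul_mulVec,
      Matrix.one_mulVec, ← sub_smul]
    rfl
  have h2 := ContinuousLinearMap.le_opNorm
    (Matrix.toEuclideanCLM (𝕜 := ℂ) (M - c • (1 : Matrix ι ι ℂ))) x
  rw [h1, norm_smul] at h2
  exact le_of_mul_le_mul_right h2 (norm_pos_iff.2 hx0)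

theorem abs_eigenvalues_sub_le_opNorm {M : Matrix ι ι ℂ} (hM : M.IsHermitian) (i : ι) (c : ℝ) :
    |hM.eigenvalues i - c| ≤ opNorm (M - (c : ℂ) • (1 : Matrix ι ι ℂ)) := by
  have hv : (hM.eigenvectorBasis i : ι → ℂ) ≠ 0 := by
    intro h0
    exact hM.eigenvectorBasis.orthonormal.ne_zero i (by ext j; exact congrFun h0 j)
  have h := norm_sub_le_opNorm_of_mulVec_eq (z := (hM.eigenvalues i : ℂ)) hv
    (hM.mulVec_eigenvectorBasis i) c
  rwa [← Complex.ofReal_sub, Complex.norm_real, Real.norm_eq_abs] at h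

theorem rank_eq_card_of_opNorm_sub_lt {M : Matrix ι ι ℂ} {c : ℂ}
    (h : opNorm (M - c • (1 : Matrix ι ι ℂ)) < ‖c‖) : M.rank = Fintype.card ι := by
  refine Matrix.rank_of_isUnit M (Matrix.mulVec_injective_iff_isUnit.1 ?_)
  refine (injective_iff_map_eq_zero (Matrix.mulVecLin M)).2 fun v hv => ?_
  by_contra hv0
  have := norm_sub_le_opNorm_of_mulVec_eq (z := 0) hv0 (by simpa using hv) c
  rw [zero_sub, norm_neg] at this
  exact absurd h this.not_gt

open scoped ComplexOrder in
/-- If the Gram matrix `W^* W` is close to the scalar matrix `c`, then the nonzero eigenvalues of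
`W W^*` are close to `c`, and there are as many of them as columns of `W`. -/
theorem exists_finset_eigenvalues_mul_conjTranspose {κ : Type*} [Fintype κ] [DecidableEq κ]
    (W : Matrix ι κ ℂ) (hM : (W * W.conjTranspose).IsHermitian) {c ε : ℝ}
    (hc : opNorm (W.conjTranspose * W - (c : ℂ) • (1 : Matrix κ κ ℂ)) < |c|)
    (hε : opNorm (W.conjTranspose * W - (c : ℂ) • (1 : Matrix κ κ ℂ)) < ε) :
    ∃ S : Finset ι, S.card = Fintype.card κ ∧ (∀ i ∈ S, |hM.eigenvalues i - c| < ε) ∧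
      ∀ i ∉ S, hM.eigenvalues i = 0 := by
  refine ⟨Finset.univ.filter fun i => hM.eigenvalues i ≠ 0, ?_, fun i hi => ?_, fun i hi => ?_⟩
  · rw [← Fintype.card_subtype, ← hM.rank_eq_card_non_zero_eigs, Matrix.rank_self_mul_conjTranspose,
      ← Matrix.rank_conjTranspose_mul_self]
    refine rank_eq_card_of_opNorm_sub_lt (c := c) ?_
    rwa [Complex.norm_real, Real.norm_eq_abs]
  · have hi0 : hM.eigenvalues i ≠ 0 := by simpa using hi
    set v : ι → ℂ := ⇑(hM.eigenvectorBasis i) with hv_def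
    have hv : (W * W.conjTranspose).mulVec v = (hM.eigenvalues i : ℂ) • v :=
      hM.mulVec_eigenvectorBasis i
    have hv0 : v ≠ 0 := by
      intro h0
      exact hM.eigenvectorBasis.orthonormal.ne_zero i (by ext j; exact congrFun h0 j)
    -- `W^* v` is an eigenvector of `W^* W` for the same eigenvalue
    have hw0 : W.conjTranspose.mulVec v ≠ 0 := by
      intro h0
      rw [← Matrix.mulVec_mulVec, h0, Matrix.mulVec_zero] at hv
      exact (smul_ne_zero (by exact_mod_cast hi0) hv0) hv.symm
    have hw : (W.conjTranspose * W).mulVec (W.conjTranspose.mulVec v) =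
        (hM.eigenvalues i : ℂ) • W.conjTranspose.mulVec v := by
      rw [← Matrix.mulVec_smul, ← hv]
      simp only [Matrix.mulVec_mulVec, Matrix.mul_assoc]
    have h := norm_sub_le_opNorm_of_mulVec_eq hw0 hw c
    rw [← Complex.ofReal_sub, Complex.norm_real, Real.norm_eq_abs] at h
    exact h.trans_lt hε
  · simpa using hi

theorem trace_mul_conjTranspose_pow {κ : Type*} [Fintype κ] [DecidableEq κ]
    (W : Matrix ι κ ℂ) {p : ℕ} (hp : 1 ≤ p) :
    ((W * W.conjTranspose) ^ p).trace = ((W.conjTranspose * W) ^ p).trace := by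
  obtain ⟨m, rfl⟩ := Nat.exists_eq_add_of_le' hp
  have h : ∀ m : ℕ, (W * W.conjTranspose) ^ m * W = W * (W.conjTranspose * W) ^ m := by
    intro m
    induction m with
    | zero => simp
    | succ m ih => rw [pow_succ', Matrix.mul_assoc, ih, pow_succ']; simp only [Matrix.mul_assoc]
  rw [pow_succ, ← Matrix.mul_assoc, h, Matrix.mul_assoc, Matrix.trace_mul_comm, pow_succ,
    Matrix.mul_assoc]

theorem trace_smul_one_pow (c : ℂ) (p : ℕ) :
    ((c • (1 : Matrix ι ι ℂ)) ^ p).trace = c ^ p * Fintype.card ι := by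
  rw [smul_pow, one_pow, Matrix.trace_smul, Matrix.trace_one, smul_eq_mul]

end OpNorm

/-! ### Convergence of random matrices of fixed size -/

section RandomMatrix

variable {ι : Type*} [Fintype ι] {Ω : ℕ → Type*} [∀ m, MeasurableSpace (Ω m)]
  (P : ∀ m, Measure (Ω m)) [∀ m, IsProbabilityMeasure (P m)] {A : ∀ m, Ω m → Matrix ι ι ℂ}
  {L : Matrix ι ι ℂ}

/-- On matrices with entries bounded by one, a continuous function varies, up to a small error, at
most proportionally to the squared Hilbert–Schmidt distance. -/
theorem exists_norm_sub_le_add_mul_hsSq {F : Matrix ι ι ℂ → ℂ} (hF : Continuous F) {ε : ℝ}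
    (hε : 0 < ε) (hL : ∀ i j, ‖L i j‖ ≤ 1) :
    ∃ C : ℝ, ∀ M : Matrix ι ι ℂ, (∀ i j, ‖M i j‖ ≤ 1) → ‖F M - F L‖ ≤ ε + C * hsSq (M - L) := by
  have hK : IsCompact (Set.univ.pi fun _ : ι => Set.univ.pi fun _ : ι =>
      Metric.closedBall (0 : ℂ) 1) :=
    isCompact_univ_pi fun _ => isCompact_univ_pi fun _ => isCompact_closedBall _ _
  have hmem : ∀ M : Matrix ι ι ℂ, (∀ i j, ‖M i j‖ ≤ 1) → (fun i j => M i j) ∈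
      Set.univ.pi fun _ : ι => Set.univ.pi fun _ : ι => Metric.closedBall (0 : ℂ) 1 :=
    fun M hM i _ j _ => by simpa using hM i j
  have hF' : Continuous fun M : ι → ι → ℂ => F (Matrix.of M) := hF
  obtain ⟨R, hR⟩ := hK.exists_bound_of_continuousOn hF'.continuousOn
  have hcont := hF'.continuousAt (x := fun i j => L i j)
  obtain ⟨δ, hδ, hδF⟩ := Metric.continuousAt_iff.1 hcont ε hε
  have hR0 : 0 ≤ R := (norm_nonneg _).trans (hR _ (hmem L hL))
  refine ⟨2 * R / δ ^ 2, fun M hM => ?_⟩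
  by_cases h : hsSq (M - L) < δ ^ 2
  · have hdist : dist (fun i j => M i j) (fun i j => L i j) < δ := by
      refine (dist_pi_lt_iff hδ).2 fun i => (dist_pi_lt_iff hδ).2 fun j => ?_
      rw [dist_eq_norm]
      refine lt_of_pow_lt_pow_left₀ 2 hδ.le (lt_of_le_of_lt ?_ h)
      calc ‖M i j - L i j‖ ^ 2 ≤ ∑ j, ‖(M - L) i j‖ ^ 2 :=
            Finset.single_le_sum (f := fun j => ‖(M - L) i j‖ ^ 2) (fun _ _ => by positivity)
              (Finset.mem_univ j)
        _ ≤ hsSq (M - L) :=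
            Finset.single_le_sum (f := fun i => ∑ j, ‖(M - L) i j‖ ^ 2) (fun _ _ => by positivity)
              (Finset.mem_univ i)
    have h1 : dist (F M) (F L) < ε := hδF hdist
    rw [dist_eq_norm] at h1
    have : 0 ≤ 2 * R / δ ^ 2 * hsSq (M - L) := mul_nonneg (by positivity) (hsSq_nonneg _)
    linarith
  · rw [not_lt] at h
    have h1 : ‖F M - F L‖ ≤ 2 * R :=
      by
      have hM' : ‖F M‖ ≤ R := hR _ (hmem M hM)
      have hL' : ‖F L‖ ≤ R := hR _ (hmem L hL)
      linarith [norm_sub_le (F M) (F L)]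
    have h2 : 2 * R ≤ 2 * R / δ ^ 2 * hsSq (M - L) := by
      calc 2 * R = 2 * R / δ ^ 2 * δ ^ 2 := by field_simp
        _ ≤ _ := by gcongr
    linarith

theorem measurable_hsSq_sub (hmeas : ∀ m i j, Measurable fun ω => A m ω i j) (m : ℕ) :
    Measurable fun ω => hsSq (A m ω - L) :=
  Finset.measurable_fun_sum _ fun i _ => Finset.measurable_fun_sum _ fun j _ =>
    ((hmeas m i j).sub_const (L i j)).norm.pow_const 2

theorem hsSq_le_card_sq {M : Matrix ι ι ℂ} {b : ℝ} (hM : ∀ i j, ‖M i j‖ ≤ b) :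
    hsSq M ≤ Fintype.card ι * (Fintype.card ι * b ^ 2) := by
  calc hsSq M ≤ ∑ _i : ι, ∑ _j : ι, b ^ 2 :=
        Finset.sum_le_sum fun i _ => Finset.sum_le_sum fun j _ =>
          pow_le_pow_left₀ (norm_nonneg _) (hM i j) 2
    _ = _ := by simp

theorem integrable_hsSq_sub (hmeas : ∀ m i j, Measurable fun ω => A m ω i j)
    (hL : ∀ i j, ‖L i j‖ ≤ 1) {m : ℕ} (hbd : ∀ ω i j, ‖A m ω i j‖ ≤ 1) :
    Integrable (fun ω => hsSq (A m ω - L)) (P m) := by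
  refine Integrable.of_bound (measurable_hsSq_sub hmeas m).aestronglyMeasurable
    (Fintype.card ι * (Fintype.card ι * (2 : ℝ) ^ 2)) (ae_of_all _ fun ω => ?_)
  rw [Real.norm_of_nonneg (hsSq_nonneg _)]
  refine hsSq_le_card_sq fun i j => ?_
  rw [Matrix.sub_apply]
  exact (norm_sub_le _ _).trans (by linarith [hbd ω i j, hL i j])

theorem tendsto_integral_hsSq_sub (hmeas : ∀ m i j, Measurable fun ω => A m ω i j)
    (hL : ∀ i j, ‖L i j‖ ≤ 1) (hbd : ∀ᶠ m in atTop, ∀ ω i j, ‖A m ω i j‖ ≤ 1)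
    (hA : ∀ i j, Tendsto (fun m => ∫ ω, ‖A m ω i j - L i j‖ ^ 2 ∂(P m)) atTop (𝓝 0)) :
    Tendsto (fun m => ∫ ω, hsSq (A m ω - L) ∂(P m)) atTop (𝓝 0) := by
  have hsum : Tendsto (fun m => ∑ i, ∑ j, ∫ ω, ‖A m ω i j - L i j‖ ^ 2 ∂(P m)) atTop (𝓝 0) := by
    simpa using tendsto_finsetSum Finset.univ fun i _ =>
      tendsto_finsetSum Finset.univ fun j _ => hA i j
  refine hsum.congr' ?_
  filter_upwards [hbd] with m hm
  have hint : ∀ i j, Integrable (fun ω => ‖A m ω i j - L i j‖ ^ 2) (P m) := by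
    intro i j
    refine Integrable.of_bound
      (((hmeas m i j).sub_const (L i j)).norm.pow_const 2).aestronglyMeasurable ((2 : ℝ) ^ 2)
      (ae_of_all _ fun ω => ?_)
    rw [Real.norm_of_nonneg (by positivity)]
    exact pow_le_pow_left₀ (norm_nonneg _)
      ((norm_sub_le _ _).trans (by linarith [hm ω i j, hL i j])) 2
  simp only [hsSq, Matrix.sub_apply]
  rw [integral_finsetSum _ fun i _ => integrable_finsetSum _ fun j _ => hint i j]
  exact Finset.sum_congr rfl fun i _ => (integral_finsetSum _ fun j _ => hint i j).symm

/-- Markov's inequality: mean square convergence implies convergence in probability. -/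
theorem tendsto_measure_le_opNorm_sub [DecidableEq ι]
    (hmeas : ∀ m i j, Measurable fun ω => A m ω i j)
    (hL : ∀ i j, ‖L i j‖ ≤ 1) (hbd : ∀ᶠ m in atTop, ∀ ω i j, ‖A m ω i j‖ ≤ 1)
    (hA : ∀ i j, Tendsto (fun m => ∫ ω, ‖A m ω i j - L i j‖ ^ 2 ∂(P m)) atTop (𝓝 0))
    {ε : ℝ} (hε : 0 < ε) :
    Tendsto (fun m => P m {ω | ε ≤ opNorm (A m ω - L)}) atTop (𝓝 0) := by
  have h := ((tendsto_integral_hsSq_sub P hmeas hL hbd hA).const_mul (ε ^ 2)⁻¹)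
  rw [mul_zero] at h
  have h' := ENNReal.tendsto_ofReal h
  rw [ENNReal.ofReal_zero] at h'
  refine tendsto_of_tendsto_of_tendsto_of_le_of_le' tendsto_const_nhds h'
    (Eventually.of_forall fun _ => zero_le) ?_
  filter_upwards [hbd] with m hm
  have hM := mul_meas_ge_le_integral_of_nonneg (μ := P m)
    (ae_of_all _ fun ω => hsSq_nonneg (A m ω - L)) (integrable_hsSq_sub P hmeas hL hm) (ε ^ 2)
  calc P m {ω | ε ≤ opNorm (A m ω - L)} ≤ P m {ω | ε ^ 2 ≤ hsSq (A m ω - L)} :=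
        measure_mono fun ω (hω : ε ≤ _) =>
          (pow_le_pow_left₀ hε.le hω 2).trans (opNorm_sq_le_hsSq _)
    _ = ENNReal.ofReal ((P m).real {ω | ε ^ 2 ≤ hsSq (A m ω - L)}) :=
        (ofReal_measureReal).symm
    _ ≤ _ := ENNReal.ofReal_le_ofReal <| by
        rw [← div_eq_inv_mul, le_div_iff₀ (by positivity), mul_comm]
        exact hM

/-- Mean square convergence to a constant, with bounded entries, implies convergence of the
expectations of continuous functions. -/
theorem tendsto_integral_continuous_comp (hmeas : ∀ m i j, Measurable fun ω => A m ω i j)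
    (hL : ∀ i j, ‖L i j‖ ≤ 1) (hbd : ∀ᶠ m in atTop, ∀ ω i j, ‖A m ω i j‖ ≤ 1)
    (hA : ∀ i j, Tendsto (fun m => ∫ ω, ‖A m ω i j - L i j‖ ^ 2 ∂(P m)) atTop (𝓝 0))
    {F : Matrix ι ι ℂ → ℂ} (hF : Continuous F) :
    Tendsto (fun m => ∫ ω, F (A m ω) ∂(P m)) atTop (𝓝 (F L)) := by
  refine Metric.tendsto_nhds.2 fun ε hε => ?_
  obtain ⟨C, hC⟩ := exists_norm_sub_le_add_mul_hsSq (L := L) hF (half_pos hε) hL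
  have h := ((tendsto_integral_hsSq_sub P hmeas hL hbd hA).const_mul C)
  rw [mul_zero] at h
  filter_upwards [hbd, h.eventually (gt_mem_nhds (half_pos hε))] with m hm hlt
  have hint := integrable_hsSq_sub P hmeas hL hm
  have hFm : Measurable fun ω => F (A m ω) := by
    have h1 : Measurable fun ω => fun i j => A m ω i j :=
      measurable_pi_lambda _ fun i => measurable_pi_lambda _ fun j => hmeas m i j
    have hF' : Continuous fun M : ι → ι → ℂ => F (Matrix.of M) := hF
    have h2 : Measurable fun M : ι → ι → ℂ => F (Matrix.of M) := hF'.measurable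
    exact h2.comp h1
  have hpt : ∀ ω, ‖F (A m ω) - F L‖ ≤ ε / 2 + C * hsSq (A m ω - L) := fun ω => hC _ (hm ω)
  have hintR : Integrable (fun ω => ε / 2 + C * hsSq (A m ω - L)) (P m) :=
    (integrable_const _).add (hint.const_mul C)
  have hintD : Integrable (fun ω => F (A m ω) - F L) (P m) :=
    hintR.mono' (hFm.sub_const _).aestronglyMeasurable (ae_of_all _ hpt)
  have hintF : Integrable (fun ω => F (A m ω)) (P m) :=
    (hintD.add (integrable_const (F L))).congr (ae_of_all _ fun ω => by simp)
  have e : ∫ ω, F (A m ω) ∂(P m) - F L = ∫ ω, (F (A m ω) - F L) ∂(P m) := by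
    rw [integral_sub hintF (integrable_const _)]
    simp
  rw [dist_eq_norm, e]
  calc ‖∫ ω, (F (A m ω) - F L) ∂(P m)‖ ≤ ∫ ω, (ε / 2 + C * hsSq (A m ω - L)) ∂(P m) :=
        norm_integral_le_of_norm_le hintR (ae_of_all _ hpt)
    _ = ε / 2 + C * ∫ ω, hsSq (A m ω - L) ∂(P m) := by
        rw [integral_add (integrable_const _) (hint.const_mul C), integral_const_mul]
        simp
    _ < ε := by linarith

end RandomMatrix

/-! ### Independent Haar pairs -/

section HaarPair

theorem IsIndepHaarPair.measurable_bellPairing {n k : ℕ} {Ω : Type*} [MeasurableSpace Ω]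
    {P : Measure Ω} {U V : Ω → Matrix.unitaryGroup (Fin n × Fin k) ℂ}
    (hUV : IsIndepHaarPair P U V) (Y₁ Y₂ : Matrix (Fin k) (Fin k) ℂ)
    (D₁ D₂ : Matrix (Fin n × Fin k) (Fin n × Fin k) ℂ) :
    Measurable fun ω => bellPairing Y₁ Y₂ D₁ D₂ (U ω) (V ω) := by
  have hm := hUV.measurable_left.prodMk hUV.measurable_right
  have hc := (continuous_bellPairing Y₁ Y₂ D₁ D₂).measurable.comp hm
  simpa only [Function.comp_def] using hc

variable {n k : ℕ} {Ω : Type*} [MeasurableSpace Ω] {P : Measure Ω} [IsProbabilityMeasure P]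
  {U V : Ω → Matrix.unitaryGroup (Fin n × Fin k) ℂ}

theorem IsIndepHaarPair.integral_norm_bellPairing_sub_sq_le (hUV : IsIndepHaarPair P U V)
    (hn : 1 ≤ n) (hk : 1 ≤ k) {Y₁ Y₂ : Matrix (Fin k) (Fin k) ℂ} (hY₁ : IsStarProjection Y₁)
    (hY₂ : IsStarProjection Y₂) (hr₁ : Y₁.rank = 1) (hr₂ : Y₂.rank = 1)
    {D₁ D₂ : Matrix (Fin n × Fin k) (Fin n × Fin k) ℂ}
    (hD₁ : ∀ X : Matrix (Fin n × Fin k) (Fin n × Fin k) ℂ, hsSq (D₁ * X) ≤ hsSq X)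
    (hD₂ : ∀ X : Matrix (Fin n × Fin k) (Fin n × Fin k) ℂ, hsSq (D₂ * X) ≤ hsSq X)
    {d : ℝ} (hd₁ : hsSq D₁ ≤ d) (hd₂ : hsSq D₂ ≤ d) :
    ∫ ω, ‖bellPairing Y₁ Y₂ D₁ D₂ (U ω) (V ω) - D₁.trace * D₂.trace / ((n : ℂ) * k) ^ 2‖ ^ 2 ∂P
      ≤ 32 * d / (n * ((n : ℝ) * k) ^ 2) := by
  have := hUV.haar_left
  have := hUV.haar_right
  have := Measure.isProbabilityMeasure_map (μ := P) hUV.measurable_left.aemeasurable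
  have := Measure.isProbabilityMeasure_map (μ := P) hUV.measurable_right.aemeasurable
  have hmap := (indepFun_iff_map_prod_eq_prod_map_map hUV.measurable_left.aemeasurable
    hUV.measurable_right.aemeasurable).1 hUV.indep
  have hcont : Continuous fun p : Matrix.unitaryGroup (Fin n × Fin k) ℂ ×
      Matrix.unitaryGroup (Fin n × Fin k) ℂ =>
      ‖bellPairing Y₁ Y₂ D₁ D₂ p.1 p.2 - D₁.trace * D₂.trace / ((n : ℂ) * k) ^ 2‖ ^ 2 :=
    ((continuous_bellPairing Y₁ Y₂ D₁ D₂).sub continuous_const).norm.pow 2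
  rw [← integral_map (hUV.measurable_left.prodMk hUV.measurable_right).aemeasurable
    hcont.measurable.aestronglyMeasurable, hmap]
  exact _root_.integral_norm_bellPairing_sub_sq_le hn hk hY₁ hY₂ hr₁ hr₂ hD₁ hD₂ hd₁ hd₂ _ _

theorem IsIndepHaarPair.integrable_trace_outputState_pow (hUV : IsIndepHaarPair P U V)
    (Y₁ Y₂ : Matrix (Fin k) (Fin k) ℂ) (p : ℕ) :
    Integrable (fun ω => (outputState Y₁ Y₂ (U ω) (V ω) ^ p).trace) P := by
  have hm := hUV.measurable_left.prodMk hUV.measurable_right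
  have := Measure.isProbabilityMeasure_map (μ := P) hm.aemeasurable
  have hcont : Continuous fun p' : Matrix.unitaryGroup (Fin n × Fin k) ℂ ×
      Matrix.unitaryGroup (Fin n × Fin k) ℂ => (outputState Y₁ Y₂ p'.1 p'.2 ^ p).trace :=
    ((continuous_outputState Y₁ Y₂).pow p).matrix_trace
  exact (hcont.integrable_of_compactSpace (P.map fun ω => (U ω, V ω))).comp_measurable hm

/-- All eigenvalues lie within `opNorm (Z - c)` of `c`, so that the integral of `f` against the
empirical spectrum is an average of values of `f` close to `f c`. -/
theorem abs_integral_empiricalSpectrum_sub_lt {Y₁ Y₂ : Matrix (Fin k) (Fin k) ℂ}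
    (h₁ : IsStarProjection Y₁) (h₂ : IsStarProjection Y₂) (hn : 1 ≤ n)
    (U V : Matrix.unitaryGroup (Fin n × Fin k) ℂ) (f : ℝ →ᵇ ℝ) {ε δ : ℝ} {c : ℝ}
    (hδ : ∀ x, |x - c| < δ → |f x - f c| < ε)
    (h : opNorm (outputState Y₁ Y₂ U V - (c : ℂ) • 1) < δ) :
    |(∫ x, f x ∂(empiricalSpectrum h₁ h₂ U V)) - f c| < ε := by
  have hn0 : (0 : ℝ) < (n : ℝ) ^ 2 := by
    have : (0 : ℝ) < n := by exact_mod_cast hn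
    positivity
  have hint : ∫ x, f x ∂(empiricalSpectrum h₁ h₂ U V) =
      ((n : ℝ) ^ 2)⁻¹ * ∑ i, f (outputEigenvalues h₁ h₂ U V i) := by
    rw [empiricalSpectrum, integral_smul_measure, integral_finsetSum_measure]
    · simp
    · intro i _
      exact f.integrable _
  have hc : f c = ((n : ℝ) ^ 2)⁻¹ * ∑ _i : Fin n × Fin n, f c := by
    rw [Finset.sum_const, Finset.card_univ, Fintype.card_prod, Fintype.card_fin, nsmul_eq_mul]
    push_cast
    rw [← pow_two]
    field_simp
  rw [hint, hc, ← mul_sub, ← Finset.sum_sub_distrib, abs_mul, abs_of_pos (inv_pos.2 hn0),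
    inv_mul_lt_iff₀ hn0]
  have hne : (Finset.univ : Finset (Fin n × Fin n)).Nonempty := ⟨(⟨0, hn⟩, ⟨0, hn⟩), by simp⟩
  calc |∑ i, (f (outputEigenvalues h₁ h₂ U V i) - f c)|
      ≤ ∑ i, |f (outputEigenvalues h₁ h₂ U V i) - f c| := Finset.abs_sum_le_sum_abs _ _
    _ < ∑ _i : Fin n × Fin n, ε := Finset.sum_lt_sum_of_nonempty hne fun i _ =>
        hδ _ ((abs_eigenvalues_sub_le_opNorm _ i c).trans_lt h)
    _ = (n : ℝ) ^ 2 * ε := by simp [pow_two]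

end HaarPair

/-! ### The two regimes -/

section Regimes

theorem inv_sq_pow_mul_sq_eq_zpow {m : ℕ} (hm : 1 ≤ m) (p : ℕ) :
    (((m : ℂ) ^ 2)⁻¹) ^ p * ((m * m : ℕ) : ℂ) = (m : ℂ) ^ (2 - 2 * (p : ℤ)) := by
  have hm0 : (m : ℂ) ≠ 0 := by exact_mod_cast (by omega : m ≠ 0)
  rw [zpow_sub₀ hm0, zpow_mul, zpow_natCast, inv_pow, zpow_ofNat]
  push_cast
  field_simp

theorem norm_inv_sq_smul_one_apply_le_one {ι : Type*} [DecidableEq ι] (m : ℕ) (i j : ι) :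
    ‖(((m : ℂ) ^ 2)⁻¹ • (1 : Matrix ι ι ℂ)) i j‖ ≤ 1 := by
  rw [Matrix.smul_apply, Matrix.one_apply]
  split_ifs
  · rcases Nat.eq_zero_or_pos m with rfl | hm
    · simp
    · have : (1 : ℝ) ≤ m := by exact_mod_cast hm
      rw [smul_eq_mul, mul_one, norm_inv, norm_pow, Complex.norm_natCast]
      exact inv_le_one_of_one_le₀ (one_le_pow₀ this)
  · simp

theorem continuous_trace_pow {ι : Type*} [Fintype ι] [DecidableEq ι] (p : ℕ) :
    Continuous fun M : Matrix ι ι ℂ => (M ^ p).trace :=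
  (continuous_id.pow p).matrix_trace

/-- Mean square convergence of the entries of the output state as the environment grows. -/
theorem tendsto_integral_norm_outputState_sub_sq {n : ℕ} (hn : 1 ≤ n) {Ω : ℕ → Type*}
    [∀ k, MeasurableSpace (Ω k)] (P : ∀ k, Measure (Ω k)) [∀ k, IsProbabilityMeasure (P k)]
    {U V : ∀ k, Ω k → Matrix.unitaryGroup (Fin n × Fin k) ℂ}
    (hUV : ∀ k, IsIndepHaarPair (P k) (U k) (V k)) {Y₁ Y₂ : ∀ k, Matrix (Fin k) (Fin k) ℂ}
    (h₁ : ∀ k, IsStarProjection (Y₁ k)) (h₂ : ∀ k, IsStarProjection (Y₂ k))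
    (hr₁ : ∀ k, 1 ≤ k → (Y₁ k).rank = 1) (hr₂ : ∀ k, 1 ≤ k → (Y₂ k).rank = 1)
    (p q : Fin n × Fin n) :
    Tendsto (fun k => ∫ ω, ‖outputState (Y₁ k) (Y₂ k) (U k ω) (V k ω) p q -
      chaoticState n p q‖ ^ 2 ∂(P k)) atTop (𝓝 0) := by
  have hn0 : (n : ℝ) ≠ 0 := by exact_mod_cast (by omega : n ≠ 0)
  have hnC : (n : ℂ) ≠ 0 := by exact_mod_cast hn0
  have hlim : Tendsto (fun k : ℕ => 32 / (n : ℝ) ^ 3 * (k : ℝ)⁻¹) atTop (𝓝 0) := by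
    simpa using (tendsto_inv_atTop_nhds_zero_nat (𝕜 := ℝ)).const_mul (32 / (n : ℝ) ^ 3)
  refine squeeze_zero' (Eventually.of_forall fun k => integral_nonneg fun ω => by positivity) ?_
    hlim
  filter_upwards [eventually_ge_atTop 1] with k hk
  have hk0 : (k : ℝ) ≠ 0 := by exact_mod_cast (by omega : k ≠ 0)
  have hkC : (k : ℂ) ≠ 0 := by exact_mod_cast hk0
  have hhs : ∀ r s : Fin n,
      hsSq (Matrix.single s r (1 : ℂ) ⊗ₖ (1 : Matrix (Fin k) (Fin k) ℂ)) ≤ k := by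
    intro r s
    rw [hsSq_kronecker, hsSq_single, hsSq_one]
    simp
  have h := (hUV k).integral_norm_bellPairing_sub_sq_le hn hk (h₁ k) (h₂ k) (hr₁ k hk) (hr₂ k hk)
    (hsSq_single_kronecker_one_mul_le p.1 q.1) (hsSq_single_kronecker_one_mul_le p.2 q.2)
    (hhs _ _) (hhs _ _)
  have hmean : (Matrix.single q.1 p.1 (1 : ℂ) ⊗ₖ (1 : Matrix (Fin k) (Fin k) ℂ)).trace *
      (Matrix.single q.2 p.2 (1 : ℂ) ⊗ₖ (1 : Matrix (Fin k) (Fin k) ℂ)).trace /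
        ((n : ℂ) * k) ^ 2 = chaoticState n p q := by
    rw [Matrix.trace_kronecker, Matrix.trace_kronecker, chaoticState, Matrix.smul_apply,
      Matrix.one_apply, Matrix.trace_one, Fintype.card_fin]
    by_cases e : p = q
    · subst e
      simp
      field_simp
    · rw [if_neg e]
      rw [Prod.ext_iff, not_and_or] at e
      rcases e with e | e
      · simp [Matrix.trace_single_eq_of_ne _ _ _ (Ne.symm e)]
      · simp [Matrix.trace_single_eq_of_ne _ _ _ (Ne.symm e)]
  simp only [outputState_apply]
  rw [hmean] at h
  refine h.trans_eq ?_
  field_simp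

/-- The Gram matrix of the Kraus vectors, whose nonzero spectrum is that of the output state. -/
noncomputable def gramState {n k : ℕ} (Y₁ Y₂ : Matrix (Fin k) (Fin k) ℂ)
    (U V : Matrix.unitaryGroup (Fin n × Fin k) ℂ) : Matrix (Fin k × Fin k) (Fin k × Fin k) ℂ :=
  fun p q => bellPairing Y₁ Y₂ (1 ⊗ₖ Matrix.single p.1 q.1 1) (1 ⊗ₖ Matrix.single p.2 q.2 1) U V

theorem exists_outputState_eq_mul_conjTranspose {n k : ℕ} {Y₁ Y₂ : Matrix (Fin k) (Fin k) ℂ}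
    (h₁ : IsStarProjection Y₁) (h₂ : IsStarProjection Y₂) (hr₁ : Y₁.rank = 1) (hr₂ : Y₂.rank = 1)
    (U V : Matrix.unitaryGroup (Fin n × Fin k) ℂ) :
    ∃ W : Matrix (Fin n × Fin n) (Fin k × Fin k) ℂ,
      outputState Y₁ Y₂ U V = W * W.conjTranspose ∧
      gramState Y₁ Y₂ U V = W.conjTranspose * W := by
  obtain ⟨y₁, hy₁, -⟩ := exists_eq_mul_star_of_rank_eq_one h₁ hr₁
  obtain ⟨y₂, hy₂, -⟩ := exists_eq_mul_star_of_rank_eq_one h₂ hr₂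
  exact ⟨krausMatrix y₁ y₂ U V, outputState_eq_krausMatrix_mul_conjTranspose hy₁ hy₂ U V,
    Matrix.ext fun p q => (conjTranspose_mul_krausMatrix_apply hy₁ hy₂ U V p q).symm⟩

/-- Mean square convergence of the entries of the Gram matrix as the system grows. -/
theorem tendsto_integral_norm_gramState_sub_sq {k : ℕ} (hk : 1 ≤ k) {Ω : ℕ → Type*}
    [∀ n, MeasurableSpace (Ω n)] (P : ∀ n, Measure (Ω n)) [∀ n, IsProbabilityMeasure (P n)]
    {U V : ∀ n, Ω n → Matrix.unitaryGroup (Fin n × Fin k) ℂ}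
    (hUV : ∀ n, IsIndepHaarPair (P n) (U n) (V n)) {Y₁ Y₂ : ℕ → Matrix (Fin k) (Fin k) ℂ}
    (h₁ : ∀ n, IsStarProjection (Y₁ n)) (h₂ : ∀ n, IsStarProjection (Y₂ n))
    (hr₁ : ∀ n, (Y₁ n).rank = 1) (hr₂ : ∀ n, (Y₂ n).rank = 1) (p q : Fin k × Fin k) :
    Tendsto (fun n => ∫ ω, ‖gramState (Y₁ n) (Y₂ n) (U n ω) (V n ω) p q -
      (((k : ℂ) ^ 2)⁻¹ • (1 : Matrix (Fin k × Fin k) (Fin k × Fin k) ℂ)) p q‖ ^ 2 ∂(P n))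
      atTop (𝓝 0) := by
  have hk0 : (k : ℝ) ≠ 0 := by exact_mod_cast (by omega : k ≠ 0)
  have hkC : (k : ℂ) ≠ 0 := by exact_mod_cast hk0
  have hlim : Tendsto (fun n : ℕ => 32 / (k : ℝ) ^ 2 * (n : ℝ)⁻¹ ^ 2) atTop (𝓝 0) := by
    simpa using ((tendsto_inv_atTop_nhds_zero_nat (𝕜 := ℝ)).pow 2).const_mul (32 / (k : ℝ) ^ 2)
  refine squeeze_zero' (Eventually.of_forall fun n => integral_nonneg fun ω => by positivity) ?_
    hlim
  filter_upwards [eventually_ge_atTop 1] with n hn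
  have hn0 : (n : ℝ) ≠ 0 := by exact_mod_cast (by omega : n ≠ 0)
  have hnC : (n : ℂ) ≠ 0 := by exact_mod_cast hn0
  have hhs : ∀ a c : Fin k,
      hsSq ((1 : Matrix (Fin n) (Fin n) ℂ) ⊗ₖ Matrix.single a c (1 : ℂ)) ≤ n := by
    intro a c
    rw [hsSq_kronecker, hsSq_single, hsSq_one]
    simp
  have h := (hUV n).integral_norm_bellPairing_sub_sq_le hn hk (h₁ n) (h₂ n) (hr₁ n) (hr₂ n)
    (hsSq_one_kronecker_single_mul_le p.1 q.1) (hsSq_one_kronecker_single_mul_le p.2 q.2)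
    (hhs _ _) (hhs _ _)
  have hmean : ((1 : Matrix (Fin n) (Fin n) ℂ) ⊗ₖ Matrix.single p.1 q.1 (1 : ℂ)).trace *
      ((1 : Matrix (Fin n) (Fin n) ℂ) ⊗ₖ Matrix.single p.2 q.2 (1 : ℂ)).trace /
        ((n : ℂ) * k) ^ 2 =
      (((k : ℂ) ^ 2)⁻¹ • (1 : Matrix (Fin k × Fin k) (Fin k × Fin k) ℂ)) p q := by
    rw [Matrix.trace_kronecker, Matrix.trace_kronecker, Matrix.smul_apply,
      Matrix.one_apply, Matrix.trace_one, Fintype.card_fin]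
    by_cases e : p = q
    · subst e
      simp
      field_simp
    · rw [if_neg e]
      rw [Prod.ext_iff, not_and_or] at e
      rcases e with e | e
      · simp [Matrix.trace_single_eq_of_ne _ _ _ e]
      · simp [Matrix.trace_single_eq_of_ne _ _ _ e]
  rw [hmean] at h
  refine h.trans_eq ?_
  field_simp

end Regimes

theorem mainTheorem5 :
    -- first regime: `n` fixed, `k → ∞`
    (∀ (n : ℕ), 1 ≤ n →
      ∀ (Ω : ℕ → Type*) [∀ k, MeasurableSpace (Ω k)]
        (P : ∀ k, Measure (Ω k)) [∀ k, IsProbabilityMeasure (P k)]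
        (U V : ∀ k, Ω k → Matrix.unitaryGroup (Fin n × Fin k) ℂ)
        (_ : ∀ k, IsIndepHaarPair (P k) (U k) (V k))
        (Y₁ Y₂ : ∀ k, Matrix (Fin k) (Fin k) ℂ)
        (h₁ : ∀ k, IsStarProjection (Y₁ k)) (h₂ : ∀ k, IsStarProjection (Y₂ k))
        (_ : ∀ k, 1 ≤ k → (Y₁ k).rank = 1) (_ : ∀ k, 1 ≤ k → (Y₂ k).rank = 1),
        (∀ p : ℕ, 1 ≤ p →
          (∀ k, Integrable
            (fun ω => (outputState (Y₁ k) (Y₂ k) (U k ω) (V k ω) ^ p).trace) (P k)) ∧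
          Tendsto
            (fun k => ∫ ω, (outputState (Y₁ k) (Y₂ k) (U k ω) (V k ω) ^ p).trace ∂(P k))
            atTop (𝓝 ((n : ℂ) ^ (2 - 2 * (p : ℤ))))) ∧
        (∀ ε : ℝ, 0 < ε →
          Tendsto
            (fun k => P k {ω | ε ≤
              opNorm (outputState (Y₁ k) (Y₂ k) (U k ω) (V k ω) - chaoticState n)})
            atTop (𝓝 0)) ∧
        (∀ f : ℝ →ᵇ ℝ, ∀ ε : ℝ, 0 < ε →
          Tendsto
            (fun k => P k {ω | ε ≤
              |(∫ x, f x ∂(empiricalSpectrum (h₁ k) (h₂ k) (U k ω) (V k ω)))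
                - f (1 / (n : ℝ) ^ 2)|})
            atTop (𝓝 0))) ∧
    -- second regime: `k` fixed, `n → ∞`
    (∀ (k : ℕ), 1 ≤ k →
      ∀ (Ω : ℕ → Type*) [∀ n, MeasurableSpace (Ω n)]
        (P : ∀ n, Measure (Ω n)) [∀ n, IsProbabilityMeasure (P n)]
        (U V : ∀ n, Ω n → Matrix.unitaryGroup (Fin n × Fin k) ℂ)
        (_ : ∀ n, IsIndepHaarPair (P n) (U n) (V n))
        (Y₁ Y₂ : ℕ → Matrix (Fin k) (Fin k) ℂ)
        (h₁ : ∀ n, IsStarProjection (Y₁ n)) (h₂ : ∀ n, IsStarProjection (Y₂ n))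
        (_ : ∀ n, (Y₁ n).rank = 1) (_ : ∀ n, (Y₂ n).rank = 1),
        (∀ p : ℕ, 1 ≤ p →
          (∀ n, Integrable
            (fun ω => (outputState (Y₁ n) (Y₂ n) (U n ω) (V n ω) ^ p).trace) (P n)) ∧
          Tendsto
            (fun n => ∫ ω, (outputState (Y₁ n) (Y₂ n) (U n ω) (V n ω) ^ p).trace ∂(P n))
            atTop (𝓝 ((k : ℂ) ^ (2 - 2 * (p : ℤ))))) ∧
        (∀ ε : ℝ, 0 < ε →
          Tendsto
            (fun n => P n {ω | ¬ ∃ S : Finset (Fin n × Fin n), S.card = k ^ 2 ∧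
              (∀ i ∈ S,
                |outputEigenvalues (h₁ n) (h₂ n) (U n ω) (V n ω) i - 1 / (k : ℝ) ^ 2| < ε) ∧
              (∀ i ∉ S, outputEigenvalues (h₁ n) (h₂ n) (U n ω) (V n ω) i = 0)})
            atTop (𝓝 0))) := by
  refine ⟨?_, ?_⟩
  · intro n hn Ω _ P _ U V hUV Y₁ Y₂ h₁ h₂ hr₁ hr₂
    have hmeas : ∀ k i j, Measurable fun ω =>
        outputState (Y₁ k) (Y₂ k) (U k ω) (V k ω) i j := fun k i j => by
      simp only [outputState_apply]
      exact (hUV k).measurable_bellPairing _ _ _ _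
    have hL : ∀ i j, ‖chaoticState n i j‖ ≤ 1 := norm_inv_sq_smul_one_apply_le_one n
    have hbd : ∀ᶠ k in atTop, ∀ ω i j,
        ‖outputState (Y₁ k) (Y₂ k) (U k ω) (V k ω) i j‖ ≤ 1 := by
      filter_upwards [eventually_ge_atTop 1] with k hk ω i j
      rw [outputState_apply]
      exact norm_bellPairing_le (h₁ k) (h₂ k) (hr₁ k hk) (hr₂ k hk)
        (hsSq_single_kronecker_one_mul_le _ _) (hsSq_single_kronecker_one_mul_le _ _) _ _
    have hA := tendsto_integral_norm_outputState_sub_sq hn P hUV h₁ h₂ hr₁ hr₂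
    have hprob : ∀ ε : ℝ, 0 < ε → Tendsto (fun k => P k {ω | ε ≤
        opNorm (outputState (Y₁ k) (Y₂ k) (U k ω) (V k ω) - chaoticState n)}) atTop (𝓝 0) :=
      fun ε hε => tendsto_measure_le_opNorm_sub P hmeas hL hbd hA hε
    refine ⟨fun p _ => ⟨fun k => (hUV k).integrable_trace_outputState_pow _ _ p, ?_⟩, hprob, ?_⟩
    · have h := tendsto_integral_continuous_comp P hmeas hL hbd hA (continuous_trace_pow p)
      rw [chaoticState, trace_smul_one_pow, Fintype.card_prod, Fintype.card_fin,
        inv_sq_pow_mul_sq_eq_zpow hn] at h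
      exact h
    · intro f ε hε
      obtain ⟨δ, hδ, hf⟩ := Metric.continuousAt_iff.1
        (f.continuous.continuousAt (x := 1 / (n : ℝ) ^ 2)) ε hε
      refine tendsto_of_tendsto_of_tendsto_of_le_of_le tendsto_const_nhds (hprob δ hδ)
        (fun _ => zero_le) fun k => measure_mono fun ω (hω : ε ≤ _) => ?_
      by_contra hlt
      refine absurd hω (abs_integral_empiricalSpectrum_sub_lt (h₁ k) (h₂ k) hn (U k ω) (V k ω) f
        (δ := δ) (fun x hx => hf hx) ?_).not_ge
      have hc : ((1 / (n : ℝ) ^ 2 : ℝ) : ℂ) • (1 : Matrix (Fin n × Fin n) (Fin n × Fin n) ℂ) =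
          chaoticState n := by
        rw [chaoticState]
        push_cast
        rw [one_div]
      rw [hc]
      exact not_le.1 hlt
  · intro k hk Ω _ P _ U V hUV Y₁ Y₂ h₁ h₂ hr₁ hr₂
    have hk0 : (0 : ℝ) < 1 / (k : ℝ) ^ 2 := by
      have : (0 : ℝ) < k := by exact_mod_cast hk
      positivity
    have hmeas : ∀ n i j, Measurable fun ω =>
        gramState (Y₁ n) (Y₂ n) (U n ω) (V n ω) i j := fun n i j =>
      (hUV n).measurable_bellPairing _ _ _ _
    have hL := norm_inv_sq_smul_one_apply_le_one (ι := Fin k × Fin k) k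
    have hbd : ∀ᶠ n in atTop, ∀ ω i j,
        ‖gramState (Y₁ n) (Y₂ n) (U n ω) (V n ω) i j‖ ≤ 1 :=
      Eventually.of_forall fun n ω i j => norm_bellPairing_le (h₁ n) (h₂ n) (hr₁ n) (hr₂ n)
        (hsSq_one_kronecker_single_mul_le _ _) (hsSq_one_kronecker_single_mul_le _ _) _ _
    have hA := tendsto_integral_norm_gramState_sub_sq hk P hUV h₁ h₂ hr₁ hr₂
    refine ⟨fun p hp => ⟨fun n => (hUV n).integrable_trace_outputState_pow _ _ p, ?_⟩, ?_⟩
    · have h := tendsto_integral_continuous_comp P hmeas hL hbd hA (continuous_trace_pow p)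
      rw [trace_smul_one_pow, Fintype.card_prod, Fintype.card_fin,
        inv_sq_pow_mul_sq_eq_zpow hk] at h
      refine h.congr fun n => integral_congr_ae (ae_of_all _ fun ω => ?_)
      obtain ⟨W, hZ, hG⟩ := exists_outputState_eq_mul_conjTranspose (h₁ n) (h₂ n) (hr₁ n) (hr₂ n)
        (U n ω) (V n ω)
      simp only [hZ, hG, trace_mul_conjTranspose_pow W hp]
    · intro ε hε
      have hprob := tendsto_measure_le_opNorm_sub P hmeas hL hbd hA (lt_min hε hk0)
      refine tendsto_of_tendsto_of_tendsto_of_le_of_le tendsto_const_nhds hprob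
        (fun _ => zero_le) fun n => measure_mono fun ω hω => ?_
      by_contra hlt
      refine hω ?_
      obtain ⟨W, hZ, hG⟩ := exists_outputState_eq_mul_conjTranspose (h₁ n) (h₂ n) (hr₁ n) (hr₂ n)
        (U n ω) (V n ω)
      have hc : ((1 / (k : ℝ) ^ 2 : ℝ) : ℂ) = ((k : ℂ) ^ 2)⁻¹ := by
        push_cast
        rw [one_div]
      have hlt' : opNorm (W.conjTranspose * W - ((1 / (k : ℝ) ^ 2 : ℝ) : ℂ) • 1) <
          min ε (1 / (k : ℝ) ^ 2) := by
        rw [hc, ← hG]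
        exact not_le.1 hlt
      have hM : (W * W.conjTranspose).IsHermitian := hZ ▸ outputState_isHermitian (h₁ n) (h₂ n) _ _
      obtain ⟨S, hS, hS₁, hS₂⟩ := exists_finset_eigenvalues_mul_conjTranspose W hM
        (hlt'.trans_le ((min_le_right _ _).trans (le_abs_self _)))
        (hlt'.trans_le (min_le_left _ _))
      have hev : outputEigenvalues (h₁ n) (h₂ n) (U n ω) (V n ω) = hM.eigenvalues := by
        unfold outputEigenvalues
        congr 1
      refine ⟨S, ?_, ?_, ?_⟩
      · rw [hS, Fintype.card_prod, Fintype.card_fin, pow_two]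
      · rwa [hev]
      · rwa [hev]
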